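/- Let $k$ be a fixed integer. For a positive integer $q$ let $$\lambda(q;k)=\#\{(x,y,z)\in\mathbb Z^3:\ 1\le x,y,z\le q,\ x^2+y^2+z^2+k\equiv 0 \pmod q\},$$ and for a real number $H\ge 1$ let $S_3(H,k)$ be the number of triples of integers $(x,y,z)$ with $1\le x,y,z\le H$ such that $x^2+y^2+z^2+k$ is square-free (an integer is square-free if it is not divisible by $p^2$ for any prime $p$; in particular $0$ is not square-free). Then the product $\prod_p\bigl(1-\lambda(p^2;k)/p^6\bigr)$ over all primes $p$ converges, and for every $\varepsilon>0$, as $H\to\infty$, $$S_3(H,k)=\prod_p\left(1-\frac{\lambda(p^2;k)}{p^6}\right)H^3+O\bigl(H^{9/4+\varepsilon}\bigr),$$ where the implied constant may depend only on $k$ and $\varepsilon$. -/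

import Mathlib

/-- `lambda q k` is the number of triples `1 ≤ x, y, z ≤ q` of integers with
`x² + y² + z² + k ≡ 0 (mod q)`. -/
def lambda (q : ℕ) (k : ℤ) : ℕ :=
  ((Finset.Icc 1 q ×ˢ Finset.Icc 1 q ×ˢ Finset.Icc 1 q).filter
    fun t : ℕ × ℕ × ℕ =>
      (t.1 : ℤ) ^ 2 + (t.2.1 : ℤ) ^ 2 + (t.2.2 : ℤ) ^ 2 + k ≡ 0 [ZMOD (q : ℤ)]).card

open Classical in
/-- `S3 H k` is the number of triples of integers `1 ≤ x, y, z ≤ H` (`H` real) for which the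
integer `x² + y² + z² + k` is square-free. The integer `0` is not square-free, and a negative
integer is square-free exactly when its absolute value is. -/
noncomputable def S3 (H : ℝ) (k : ℤ) : ℕ :=
  ((Finset.Icc 1 ⌊H⌋₊ ×ˢ Finset.Icc 1 ⌊H⌋₊ ×ˢ Finset.Icc 1 ⌊H⌋₊).filter
    fun t : ℕ × ℕ × ℕ =>
      Squarefree ((t.1 : ℤ) ^ 2 + (t.2.1 : ℤ) ^ 2 + (t.2.2 : ℤ) ^ 2 + k)).card

/-!
Summing the Möbius function over the square divisors of `x² + y² + z² + k` reduces the problem to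
counting, for square-free `d`, the points `(x, y, z)` of a box of side `N` with
`d² ∣ x² + y² + z² + k`. Completing the sum modulo `d²`, the zero frequency gives the main term; at
any other frequency, shifting the variables by multiples of `d` shows that only the critical points
of the phase modulo `d` contribute to the exponential sum over the quadric, and these are counted
prime by prime. Summed over `d ≤ D`, the errors are `O(N ^ ε * (D ^ 3 + N ^ 2))`. For `d > D` one
fixes one variable and the quotient of the value by `d²`; the remaining two variables represent a
fixed integer as a sum of two squares, which can be done in `O(N ^ ε)` ways, so that these `d`
contribute `O(N ^ (3 + ε) / D)`. The two bounds balance at `D = N ^ (3 / 4)`, and the resulting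
singular series factors into the Euler product because its terms are multiplicative.
-/

section Divisors

theorem exists_add_one_le_mul_two_rpow {ε : ℝ} (hε : 0 < ε) :
    ∃ K : ℝ, 1 ≤ K ∧ ∀ e : ℕ, (e : ℝ) + 1 ≤ K * (2 : ℝ) ^ (ε * e) := by
  have : 0 < Real.log 2 := Real.log_pos one_lt_two
  refine ⟨1 + 1 / (ε * Real.log 2), le_add_of_nonneg_right (by positivity), fun e => ?_⟩
  have hexp : ε * Real.log 2 * e + 1 ≤ (2 : ℝ) ^ (ε * e) := by
    have h := Real.add_one_le_exp (Real.log 2 * (ε * e))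
    rw [← Real.rpow_def_of_pos two_pos] at h
    linarith
  calc (e : ℝ) + 1 ≤ (e : ℝ) + 1 + (ε * Real.log 2 * e + 1 / (ε * Real.log 2)) := by
        simp only [le_add_iff_nonneg_right]; positivity
    _ = (1 + 1 / (ε * Real.log 2)) * (ε * Real.log 2 * e + 1) := by field_simp; ring
    _ ≤ _ := by gcongr

theorem add_one_le_rpow_pow {ε p : ℝ} (hε : 0 < ε) (hp : (2 : ℝ) ^ (1 / ε) ≤ p) (e : ℕ) :
    (e : ℝ) + 1 ≤ (p ^ ε) ^ e := by
  have h2 : (2 : ℝ) ≤ p ^ ε := calc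
    (2 : ℝ) = ((2 : ℝ) ^ (1 / ε)) ^ ε := by
      rw [← Real.rpow_mul zero_le_two, one_div_mul_cancel hε.ne', Real.rpow_one]
    _ ≤ p ^ ε := by gcongr
  calc (e : ℝ) + 1 ≤ 2 ^ e := by exact_mod_cast Nat.lt_two_pow_self
    _ ≤ _ := by gcongr

/- Only the primes `p < 2 ^ (1 / ε)` have a local factor `(e + 1) / p ^ (ε * e)` exceeding `1`. -/
theorem exists_card_divisors_le {ε : ℝ} (hε : 0 < ε) :
    ∃ C : ℝ, 1 ≤ C ∧ ∀ n : ℕ, n ≠ 0 → (n.divisors.card : ℝ) ≤ C * (n : ℝ) ^ ε := by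
  obtain ⟨K, hK1, hK⟩ := exists_add_one_le_mul_two_rpow hε
  obtain ⟨B, hB⟩ := exists_nat_ge ((2 : ℝ) ^ (1 / ε))
  refine ⟨K ^ B, one_le_pow₀ hK1, fun n hn => ?_⟩
  have hlocal : ∀ p ∈ n.primeFactors, ((n.factorization p + 1 : ℕ) : ℝ) ≤
      (if p < B then K else 1) * ((p : ℝ) ^ ε) ^ n.factorization p := by
    intro p hp
    push_cast
    split_ifs with hpB
    · have hp2 : (2 : ℝ) ≤ p := by exact_mod_cast (Nat.prime_of_mem_primeFactors hp).two_le
      rw [← Real.rpow_mul_natCast p.cast_nonneg]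
      exact (hK _).trans (by gcongr)
    · rw [one_mul]
      exact add_one_le_rpow_pow hε (hB.trans (by exact_mod_cast not_lt.1 hpB)) _
  have hsmall : (n.primeFactors.filter (· < B)).card ≤ B := by
    refine (Finset.card_le_card fun p hp => ?_).trans (Finset.card_range B).le
    exact Finset.mem_range.2 (Finset.mem_filter.1 hp).2
  have hn_rpow : ∏ p ∈ n.primeFactors, ((p : ℝ) ^ ε) ^ n.factorization p = (n : ℝ) ^ ε := by
    conv_rhs => rw [← Nat.prod_factorization_pow_eq_self hn,
      Nat.prod_factorization_eq_prod_primeFactors]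
    push_cast
    rw [← Real.finsetProd_rpow _ _ fun _ _ => by positivity]
    refine Finset.prod_congr rfl fun p _ => ?_
    rw [← Real.rpow_mul_natCast p.cast_nonneg, ← Real.rpow_natCast_mul p.cast_nonneg, mul_comm]
  calc (n.divisors.card : ℝ) = ∏ p ∈ n.primeFactors, ((n.factorization p + 1 : ℕ) : ℝ) := by
        rw [Nat.card_divisors hn, Nat.cast_prod]
    _ ≤ ∏ p ∈ n.primeFactors, (if p < B then K else 1) * ((p : ℝ) ^ ε) ^ n.factorization p :=
        Finset.prod_le_prod (fun _ _ => by positivity) hlocal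
    _ = K ^ (n.primeFactors.filter (· < B)).card * (n : ℝ) ^ ε := by
        rw [Finset.prod_mul_distrib, ← Finset.prod_filter, Finset.prod_const, hn_rpow]
    _ ≤ K ^ B * (n : ℝ) ^ ε := by gcongr

theorem sum_Icc_filter_dvd {M : Type*} [AddCommMonoid M] (D : ℕ) {f : ℕ} (hf : 0 < f) (g : ℕ → M) :
    ∑ d ∈ Finset.Icc 1 D with f ∣ d, g d = ∑ j ∈ Finset.Icc 1 (D / f), g (f * j) := by
  refine (Finset.sum_bij (fun j _ => f * j) ?_ ?_ ?_ fun _ _ => rfl).symm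
  · intro j hj
    rw [Finset.mem_Icc] at hj
    rw [Finset.mem_filter, Finset.mem_Icc, mul_comm f j]
    exact ⟨⟨Nat.mul_pos hj.1 hf, (Nat.le_div_iff_mul_le hf).1 hj.2⟩, dvd_mul_left _ _⟩
  · exact fun _ _ _ _ h => Nat.eq_of_mul_eq_mul_left hf h
  · intro d hd
    obtain ⟨hd, j, rfl⟩ := Finset.mem_filter.1 hd
    rw [Finset.mem_Icc, mul_comm f j] at hd
    exact ⟨j, Finset.mem_Icc.2 ⟨Nat.pos_of_mul_pos_right hd.1,
      (Nat.le_div_iff_mul_le hf).2 hd.2⟩, rfl⟩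

theorem gcd_le_sum_divisors (m : ℕ) {n : ℕ} (hn : n ≠ 0) :
    Nat.gcd m n ≤ ∑ f ∈ n.divisors with f ∣ m, f :=
  Finset.single_le_sum (f := fun f : ℕ => f) (fun _ _ => Nat.zero_le _) (Finset.mem_filter.2
    ⟨Nat.mem_divisors.2 ⟨Nat.gcd_dvd_right m n, hn⟩, Nat.gcd_dvd_left m n⟩)

theorem sum_gcd_le (D : ℕ) {n : ℕ} (hn : n ≠ 0) :
    ∑ d ∈ Finset.Icc 1 D, Nat.gcd d n ≤ D * n.divisors.card := calc
  ∑ d ∈ Finset.Icc 1 D, Nat.gcd d n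
    ≤ ∑ d ∈ Finset.Icc 1 D, ∑ f ∈ n.divisors with f ∣ d, f :=
      Finset.sum_le_sum fun d _ => gcd_le_sum_divisors d hn
  _ = ∑ f ∈ n.divisors, ∑ d ∈ Finset.Icc 1 D with f ∣ d, f := by
      simp only [Finset.sum_filter]; exact Finset.sum_comm
  _ ≤ ∑ _f ∈ n.divisors, D := Finset.sum_le_sum fun f hf => by
      rw [sum_Icc_filter_dvd D (Nat.pos_of_mem_divisors hf), Finset.sum_const, Nat.card_Icc,
        add_tsub_cancel_right, smul_eq_mul]
      exact Nat.div_mul_le_self D f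
  _ = D * n.divisors.card := by rw [Finset.sum_const, smul_eq_mul, mul_comm]

theorem sum_Icc_filter_dvd_one_div_le (D : ℕ) {f : ℕ} (hf : 0 < f) :
    ∑ i ∈ Finset.Icc 1 D with f ∣ i, (1 : ℝ) / i ≤
      1 / f * ∑ i ∈ Finset.Icc 1 D, (1 : ℝ) / i := by
  rw [sum_Icc_filter_dvd D hf, Finset.mul_sum]
  calc ∑ j ∈ Finset.Icc 1 (D / f), (1 : ℝ) / (f * j : ℕ)
      = ∑ j ∈ Finset.Icc 1 (D / f), 1 / (f : ℝ) * (1 / j) := by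
        refine Finset.sum_congr rfl fun j _ => ?_
        rw [Nat.cast_mul, one_div_mul_one_div]
    _ ≤ ∑ j ∈ Finset.Icc 1 D, 1 / (f : ℝ) * (1 / j) :=
        Finset.sum_le_sum_of_subset_of_nonneg
          (Finset.Icc_subset_Icc_right (Nat.div_le_self D f)) fun _ _ _ => by positivity

theorem sum_gcd_div_mul_le (A B : ℕ) :
    ∑ i ∈ Finset.Icc 1 A, ∑ j ∈ Finset.Icc 1 B, (Nat.gcd i j : ℝ) / (i * j) ≤
      (∑ i ∈ Finset.Icc 1 A, (1 : ℝ) / i) * (∑ j ∈ Finset.Icc 1 B, (1 : ℝ) / j) ^ 2 := by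
  have hgcd : ∀ i, ∀ j ∈ Finset.Icc 1 B, (Nat.gcd i j : ℝ) / (i * j) ≤
      ∑ f ∈ Finset.Icc 1 B, if f ∣ i ∧ f ∣ j then (f : ℝ) * (1 / i * (1 / j)) else 0 := by
    intro i j hj
    obtain ⟨hj1, hjB⟩ := Finset.mem_Icc.1 hj
    have hmem : Nat.gcd i j ∈ Finset.Icc 1 B := Finset.mem_Icc.2
      ⟨Nat.gcd_pos_of_pos_right _ hj1, (Nat.gcd_le_right _ hj1).trans hjB⟩
    refine le_trans (le_of_eq ?_) (Finset.single_le_sum (fun f _ => ?_) hmem)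
    · rw [if_pos ⟨Nat.gcd_dvd_left i j, Nat.gcd_dvd_right i j⟩, one_div_mul_one_div, mul_one_div]
    · positivity
  calc ∑ i ∈ Finset.Icc 1 A, ∑ j ∈ Finset.Icc 1 B, (Nat.gcd i j : ℝ) / (i * j)
      ≤ ∑ i ∈ Finset.Icc 1 A, ∑ j ∈ Finset.Icc 1 B, ∑ f ∈ Finset.Icc 1 B,
          if f ∣ i ∧ f ∣ j then (f : ℝ) * (1 / i * (1 / j)) else 0 :=
        Finset.sum_le_sum fun i _ => Finset.sum_le_sum fun j hj => hgcd i j hj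
    _ = ∑ f ∈ Finset.Icc 1 B, (f : ℝ) * ((∑ i ∈ Finset.Icc 1 A with f ∣ i, (1 : ℝ) / i) *
          ∑ j ∈ Finset.Icc 1 B with f ∣ j, (1 : ℝ) / j) := by
        conv_lhs => enter [2, i]; rw [Finset.sum_comm]
        rw [Finset.sum_comm]
        simp only [Finset.sum_mul_sum]
        simp only [Finset.mul_sum, Finset.sum_filter, ite_and]
        refine Finset.sum_congr rfl fun f _ => Finset.sum_congr rfl fun i _ => ?_
        split_ifs
        · simp only [Finset.mul_sum, mul_ite, mul_zero]
        · simp only [Finset.sum_const_zero, mul_zero]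
    _ ≤ ∑ f ∈ Finset.Icc 1 B, (f : ℝ) * ((1 / f * ∑ i ∈ Finset.Icc 1 A, (1 : ℝ) / i) *
          (1 / f * ∑ j ∈ Finset.Icc 1 B, (1 : ℝ) / j)) := by
        refine Finset.sum_le_sum fun f hf => ?_
        have hf0 : 0 < f := (Finset.mem_Icc.1 hf).1
        gcongr <;> exact sum_Icc_filter_dvd_one_div_le _ hf0
    _ = ∑ f ∈ Finset.Icc 1 B, 1 / (f : ℝ) * ((∑ i ∈ Finset.Icc 1 A, (1 : ℝ) / i) *
          ∑ j ∈ Finset.Icc 1 B, (1 : ℝ) / j) := by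
        refine Finset.sum_congr rfl fun f hf => ?_
        have hf0 : 0 < f := (Finset.mem_Icc.1 hf).1
        field_simp
    _ = _ := by rw [← Finset.sum_mul]; ring

theorem sum_gcd_div_mul_le_pow_three {A B : ℕ} (hAB : A ≤ B) {X : ℝ}
    (hX : ∑ i ∈ Finset.Icc 1 B, (1 : ℝ) / i ≤ X) :
    ∑ i ∈ Finset.Icc 1 A, ∑ j ∈ Finset.Icc 1 B, (Nat.gcd i j : ℝ) / (i * j) ≤ X ^ 3 := by
  have hA : ∑ i ∈ Finset.Icc 1 A, (1 : ℝ) / i ≤ X :=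
    (Finset.sum_le_sum_of_subset_of_nonneg (Finset.Icc_subset_Icc le_rfl hAB)
      fun _ _ _ => by positivity).trans hX
  have hX0 : 0 ≤ X := (Finset.sum_nonneg fun _ _ => by positivity).trans hX
  calc _ ≤ X * X ^ 2 := (sum_gcd_div_mul_le A B).trans (by gcongr)
    _ = X ^ 3 := by ring

theorem exists_sum_one_div_le {ε : ℝ} (hε : 0 < ε) :
    ∃ C : ℝ, 1 ≤ C ∧ ∀ A : ℕ, 1 ≤ A → ∑ i ∈ Finset.Icc 1 A, (1 : ℝ) / i ≤ C * (A : ℝ) ^ ε := by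
  refine ⟨1 + 1 / ε, le_add_of_nonneg_right (by positivity), fun A hA => ?_⟩
  have hA' : (1 : ℝ) ≤ A := by exact_mod_cast hA
  calc ∑ i ∈ Finset.Icc 1 A, (1 : ℝ) / i = (harmonic A : ℝ) := by
        simp [harmonic_eq_sum_Icc]
    _ ≤ 1 + Real.log A := harmonic_le_one_add_log A
    _ ≤ (A : ℝ) ^ ε + (A : ℝ) ^ ε / ε := by
        gcongr
        exacts [Real.one_le_rpow hA' hε.le, Real.log_le_rpow_div (by positivity) hε]
    _ = _ := by ring

end Divisors

section SumTwoSquares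

theorem dvd_two_mul_sub_of_gcd_eq {n a b c : ℤ} (hc : IsCoprime n c) (ha : n ∣ a ^ 2 - c ^ 2)
    (hb : n ∣ b ^ 2 - c ^ 2) (hgcd : n.gcd (a - c) = n.gcd (b - c)) : n ∣ 2 * (a - b) := by
  have dvd_gcd_mul : ∀ {x : ℤ}, n ∣ x ^ 2 - c ^ 2 → n ∣ n.gcd (x - c) * (x + c) := by
    intro x hx
    rw [Int.gcd_eq_gcd_ab, add_mul]
    refine dvd_add ⟨n.gcdA (x - c) * (x + c), mul_assoc _ _ _⟩
      ((hx.mul_right (n.gcdB (x - c))).trans (dvd_of_eq ?_))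
    ring
  have hga := dvd_gcd_mul ha
  have hgb := dvd_gcd_mul hb
  have hga' : (n.gcd (a - c) : ℤ) ∣ a - c := Int.gcd_dvd_right n (a - c)
  have hgb' : (n.gcd (a - c) : ℤ) ∣ b - c := hgcd ▸ Int.gcd_dvd_right n (b - c)
  rw [← hgcd] at hgb
  generalize (n.gcd (a - c) : ℤ) = g at hga hgb hga' hgb'
  have hplus : n ∣ (a + c) * (a - b) := by
    obtain ⟨m, hm⟩ : g ∣ a - b := by simpa using dvd_sub hga' hgb'
    exact hm ▸ (hga.mul_right m).trans (dvd_of_eq (by ring))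
  have hminus : n ∣ (a - c) * (a - b) := by
    obtain ⟨m, hm⟩ := hga'
    have hab : n ∣ g * (a - b) := (dvd_sub hga hgb).trans (dvd_of_eq (by ring))
    exact hm ▸ (hab.mul_right m).trans (dvd_of_eq (by ring))
  refine hc.dvd_of_dvd_mul_left ((dvd_sub hplus hminus).trans (dvd_of_eq ?_))
  ring

theorem card_filter_sq_eq_le (n : ℕ) [NeZero n] (u : (ZMod n)ˣ) :
    (Finset.univ.filter fun r : ZMod n => r ^ 2 = u).card ≤ 2 * n.divisors.card := by
  rcases (Finset.univ.filter fun r : ZMod n => r ^ 2 = u).eq_empty_or_nonempty with h | ⟨c, hc⟩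
  · simp [h]
  have hc : c ^ 2 = u := (Finset.mem_filter.1 hc).2
  have hcop : IsCoprime (n : ℤ) (c.val : ℤ) := by
    have : IsUnit c := (isUnit_pow_iff two_ne_zero).1 (hc ▸ u.isUnit)
    rw [← ZMod.natCast_zmod_val c, ZMod.isUnit_iff_coprime] at this
    exact Nat.isCoprime_iff_coprime.2 this.symm
  have hdvd : ∀ {r : ZMod n}, r ^ 2 = u → (n : ℤ) ∣ (r.val : ℤ) ^ 2 - (c.val : ℤ) ^ 2 := by
    intro r hr
    rw [← ZMod.intCast_zmod_eq_zero_iff_dvd]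
    simp [hr, hc]
  refine Finset.card_le_mul_card_image_of_maps_to
    (f := fun r : ZMod n => Int.gcd n (r.val - c.val)) (fun r _ => ?_) 2 fun g _ => ?_
  · exact Nat.mem_divisors.2
      ⟨Int.natCast_dvd_natCast.1 (Int.gcd_dvd_left (n : ℤ) (r.val - c.val)), NeZero.ne n⟩
  rcases ((Finset.univ.filter fun r : ZMod n => r ^ 2 = u).filter
    fun r => Int.gcd n (r.val - c.val) = g).eq_empty_or_nonempty with h | ⟨b, hb⟩
  · rw [h, Finset.card_empty]; exact zero_le_two
  obtain ⟨hb, hbg⟩ := Finset.mem_filter.1 hb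
  refine (Finset.card_le_card_of_injOn (· - b) (fun a ha => ?_)
    (sub_left_injective.injOn)).trans (IsAddCyclic.card_nsmul_eq_zero_le (α := ZMod n) two_pos)
  obtain ⟨ha, hag⟩ := Finset.mem_filter.1 ha
  have h2 := dvd_two_mul_sub_of_gcd_eq hcop (hdvd (Finset.mem_filter.1 ha).2)
    (hdvd (Finset.mem_filter.1 hb).2) (hag.trans hbg.symm)
  rw [← ZMod.intCast_zmod_eq_zero_iff_dvd] at h2
  simpa using h2

/- The ratio `z / y` modulo `n` is a square root of `-1` which determines the representation. -/
theorem card_primitive_sum_two_squares_le {n : ℕ} (hn : n ≠ 0) {s : Finset (ℕ × ℕ)}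
    (hs : ∀ p ∈ s, 0 < p.1 ∧ 0 < p.2 ∧ p.1 ^ 2 + p.2 ^ 2 = n ∧ Nat.Coprime p.1 p.2) :
    s.card ≤ 2 * n.divisors.card := by
  have : NeZero n := ⟨hn⟩
  have hunit : ∀ p ∈ s, IsUnit (p.1 : ZMod n) := by
    intro p hp
    obtain ⟨-, -, hpn, hcop⟩ := hs p hp
    rw [ZMod.isUnit_iff_coprime, ← hpn, sq, add_comm, Nat.coprime_add_mul_left_right]
    exact hcop.pow_right 2
  refine (Finset.card_le_card_of_injOn (fun p => (p.2 : ZMod n) * (p.1 : ZMod n)⁻¹) ?_ ?_).trans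
    (card_filter_sq_eq_le n (-1))
  · intro p hp
    obtain ⟨-, -, hpn, -⟩ := hs p hp
    have hsum : (p.1 : ZMod n) ^ 2 + (p.2 : ZMod n) ^ 2 = 0 := by
      rw [← Nat.cast_pow, ← Nat.cast_pow, ← Nat.cast_add, hpn, ZMod.natCast_self]
    have hinv := ZMod.mul_inv_of_unit _ (hunit p hp)
    simp only [Finset.coe_filter, Finset.mem_univ, true_and, Set.mem_ofPred_eq, Units.val_neg,
      Units.val_one]
    linear_combination (p.1 : ZMod n)⁻¹ ^ 2 * hsum - (1 + p.1 * (p.1 : ZMod n)⁻¹) * hinv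
  · intro p hp q hq hpq
    obtain ⟨hp1, hp2, hpn, hpc⟩ := hs p hp
    obtain ⟨hq1, hq2, hqn, hqc⟩ := hs q hq
    have hmod : p.2 * q.1 ≡ q.2 * p.1 [MOD n] := by
      rw [← ZMod.natCast_eq_natCast_iff]
      push_cast
      have hpi := ZMod.mul_inv_of_unit _ (hunit p hp)
      have hqi := ZMod.mul_inv_of_unit _ (hunit q hq)
      dsimp only at hpq
      linear_combination (p.1 * q.1 : ZMod n) * hpq - (p.2 * q.1 : ZMod n) * hpi
        + (q.2 * p.1 : ZMod n) * hqi
    have hcross : p.2 * q.1 = q.2 * p.1 :=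
      hmod.eq_of_lt_of_lt (by nlinarith) (by nlinarith)
    have h1 : p.1 = q.1 := Nat.dvd_antisymm
      (hpc.dvd_of_dvd_mul_left (hcross ▸ dvd_mul_left _ _))
      (hqc.dvd_of_dvd_mul_left (hcross ▸ dvd_mul_left _ _))
    rw [h1] at hcross
    exact Prod.ext h1 (Nat.eq_of_mul_eq_mul_right hq1 hcross)

theorem card_sum_two_squares_gcd_eq_le {n g : ℕ} (hn : n ≠ 0) {s : Finset (ℕ × ℕ)}
    (hs : ∀ p ∈ s, 0 < p.1 ∧ 0 < p.2 ∧ p.1 ^ 2 + p.2 ^ 2 = n ∧ Nat.gcd p.1 p.2 = g) :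
    s.card ≤ 2 * n.divisors.card := by
  rcases s.eq_empty_or_nonempty with rfl | ⟨p₀, hp₀⟩
  · simp
  have hg : 0 < g := by
    obtain ⟨hpos, -, -, rfl⟩ := hs p₀ hp₀
    exact Nat.gcd_pos_of_pos_left _ hpos
  have hdiv : ∀ p ∈ s, p.1 = g * (p.1 / g) ∧ p.2 = g * (p.2 / g) ∧
      Nat.Coprime (p.1 / g) (p.2 / g) ∧ n = g ^ 2 * ((p.1 / g) ^ 2 + (p.2 / g) ^ 2) := by
    intro p hp
    obtain ⟨-, -, hsum, rfl⟩ := hs p hp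
    have h₁ := Nat.mul_div_cancel' (Nat.gcd_dvd_left p.1 p.2)
    have h₂ := Nat.mul_div_cancel' (Nat.gcd_dvd_right p.1 p.2)
    refine ⟨h₁.symm, h₂.symm, Nat.coprime_div_gcd_div_gcd hg, ?_⟩
    rw [mul_add, ← mul_pow, ← mul_pow, h₁, h₂, hsum]
  have hgn : g ^ 2 ∣ n := ⟨_, (hdiv p₀ hp₀).2.2.2⟩
  have hinj : Set.InjOn (fun p : ℕ × ℕ => (p.1 / g, p.2 / g)) s := by
    intro p hp q hq h
    simp only [Prod.mk.injEq] at h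
    obtain ⟨hp₁, hp₂, -⟩ := hdiv p hp
    obtain ⟨hq₁, hq₂, -⟩ := hdiv q hq
    exact Prod.ext (by rw [hp₁, hq₁, h.1]) (by rw [hp₂, hq₂, h.2])
  rw [← Finset.card_image_of_injOn hinj]
  refine (card_primitive_sum_two_squares_le
    ((Nat.div_pos (Nat.le_of_dvd (Nat.pos_of_ne_zero hn) hgn) (by positivity)).ne')
    (n := n / g ^ 2) fun p hp => ?_).trans ?_
  · obtain ⟨q, hq, rfl⟩ := Finset.mem_image.1 hp
    obtain ⟨hq₁, hq₂, hcop, hqn⟩ := hdiv q hq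
    obtain ⟨hpos₁, hpos₂, -⟩ := hs q hq
    refine ⟨Nat.pos_of_mul_pos_left (hq₁ ▸ hpos₁), Nat.pos_of_mul_pos_left (hq₂ ▸ hpos₂), ?_, hcop⟩
    exact (Nat.div_eq_of_eq_mul_right (by positivity) hqn).symm
  · gcongr
    exact Nat.div_dvd_of_dvd hgn

theorem card_sum_two_squares_le {n : ℕ} (hn : n ≠ 0) {s : Finset (ℕ × ℕ)}
    (hs : ∀ p ∈ s, 0 < p.1 ∧ 0 < p.2 ∧ p.1 ^ 2 + p.2 ^ 2 = n) :
    s.card ≤ 2 * n.divisors.card ^ 2 := by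
  rw [sq, ← mul_assoc]
  refine Finset.card_le_mul_card_image_of_maps_to (f := fun p => Nat.gcd p.1 p.2)
    (fun p hp => ?_) _ fun g _ => card_sum_two_squares_gcd_eq_le (g := g) hn fun p hp => ?_
  · rw [Nat.mem_divisors, ← (hs p hp).2.2, sq, sq]
    exact ⟨dvd_add ((Nat.gcd_dvd_left _ _).mul_right _) ((Nat.gcd_dvd_right _ _).mul_right _),
      by have := (hs p hp).1; positivity⟩
  · obtain ⟨hmem, hgcd⟩ := Finset.mem_filter.1 hp
    obtain ⟨hpos₁, hpos₂, hsum⟩ := hs p hmem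
    exact ⟨hpos₁, hpos₂, hsum, hgcd⟩

end SumTwoSquares

section CriticalSystem

variable {ι : Type*} [Fintype ι]

/-- The points over `ZMod q` of the affine quadric `x ⬝ᵥ x + k = 0`, with `x` a vector indexed by
`ι`. -/
def quadric (ι : Type*) [Fintype ι] [DecidableEq ι] (q : ℕ) [NeZero q] (k : ℤ) :
    Finset (ι → ZMod q) := {x | x ⬝ᵥ x + (k : ZMod q) = 0}

/-- The critical points `(x, t)` modulo `d` of the phase `t * (x ⬝ᵥ x + k) + x ⬝ᵥ u`, that is, the
common zeros of its partial derivatives `x ⬝ᵥ x + k` and `2 * t * x i + u i`. -/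
def critSystem [DecidableEq ι] (d : ℕ) [NeZero d] (k : ℤ) (u : ι → ℤ) :
    Finset ((ι → ZMod d) × ZMod d) :=
  {v | v.1 ⬝ᵥ v.1 + (k : ZMod d) = 0 ∧ ∀ i, 2 * v.2 * v.1 i + (u i : ZMod d) = 0}

variable [DecidableEq ι] {k : ℤ} {u : ι → ℤ}

theorem mem_quadric {q : ℕ} [NeZero q] {x : ι → ZMod q} :
    x ∈ quadric ι q k ↔ x ⬝ᵥ x + (k : ZMod q) = 0 := by
  simp [quadric]

theorem mem_critSystem {d : ℕ} [NeZero d] {v : (ι → ZMod d) × ZMod d} :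
    v ∈ critSystem d k u ↔
      v.1 ⬝ᵥ v.1 + (k : ZMod d) = 0 ∧ ∀ i, 2 * v.2 * v.1 i + (u i : ZMod d) = 0 := by
  simp [critSystem]

theorem map_mem_critSystem {d e : ℕ} [NeZero d] [NeZero e] (φ : ZMod d →+* ZMod e)
    {v : (ι → ZMod d) × ZMod d} (hv : v ∈ critSystem d k u) :
    (φ ∘ v.1, φ v.2) ∈ critSystem e k u := by
  rw [mem_critSystem] at hv ⊢
  refine ⟨?_, fun i => ?_⟩
  · simpa [RingHom.map_dotProduct] using congrArg φ hv.1
  · simpa [map_ofNat φ 2] using congrArg φ (hv.2 i)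

theorem card_critSystem_mul_le {m n : ℕ} [NeZero m] [NeZero n] (h : Nat.Coprime m n)
    (k : ℤ) (u : ι → ℤ) :
    (critSystem (m * n) k u).card ≤ (critSystem m k u).card * (critSystem n k u).card := by
  let e := ZMod.chineseRemainder h
  let φ : ZMod (m * n) →+* ZMod m := (RingHom.fst _ _).comp e.toRingHom
  let ψ : ZMod (m * n) →+* ZMod n := (RingHom.snd _ _).comp e.toRingHom
  have hinj : ∀ {x y}, φ x = φ y → ψ x = ψ y → x = y := fun h1 h2 => e.injective (Prod.ext h1 h2)
  rw [← Finset.card_product]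
  refine Finset.card_le_card_of_injOn (fun v => ((φ ∘ v.1, φ v.2), (ψ ∘ v.1, ψ v.2))) ?_ ?_
  · intro v hv
    exact Finset.mem_coe.2 (Finset.mem_product.2
      ⟨map_mem_critSystem φ hv, map_mem_critSystem ψ hv⟩)
  · rintro ⟨x, t⟩ - ⟨y, s⟩ - hv
    simp only [Prod.mk.injEq] at hv ⊢
    obtain ⟨⟨hφ, hφt⟩, hψ, hψt⟩ := hv
    exact ⟨funext fun i => hinj (congrFun hφ i) (congrFun hψ i), hinj hφt hψt⟩

omit [DecidableEq ι] in
theorem sum_intCast_sq_eq_zero_iff_dvd (q : ℕ) (u : ι → ℤ) :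
    ∑ i, (u i : ZMod q) ^ 2 = 0 ↔ q ∣ ∑ i, (u i).natAbs ^ 2 := by
  have hcast : ((∑ i, (u i).natAbs ^ 2 : ℕ) : ℤ) = ∑ i, u i ^ 2 := by
    push_cast
    simp only [sq_abs]
  rw [← ZMod.natCast_eq_zero_iff, ← Int.cast_natCast, hcast]
  push_cast
  rfl

theorem card_filter_sq_eq_le_two {R : Type*} [CommRing R] [IsDomain R] [Fintype R] [DecidableEq R]
    (c : R) : (Finset.univ.filter fun t : R => t ^ 2 = c).card ≤ 2 := by
  rcases (Finset.univ.filter fun t : R => t ^ 2 = c).eq_empty_or_nonempty with h | ⟨r, hr⟩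
  · simp only [h, Finset.card_empty, zero_le]
  · refine (Finset.card_le_card (t := {r, -r}) fun t ht => ?_).trans Finset.card_le_two
    simp only [Finset.mem_filter_univ, Finset.mem_insert, Finset.mem_singleton] at hr ht ⊢
    exact sq_eq_sq_iff_eq_or_eq_neg.1 (ht.trans hr.symm)

theorem card_quadric_prime_le [Nonempty ι] {p : ℕ} [Fact p.Prime] (k : ℤ) :
    (quadric ι p k).card ≤ 2 * p ^ (Fintype.card ι - 1) := by
  obtain ⟨i₀⟩ := ‹Nonempty ι›
  have hcard : (Finset.univ : Finset ({i // i ≠ i₀} → ZMod p)).card = p ^ (Fintype.card ι - 1) := by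
    simp [Finset.card_univ, ZMod.card]
  rw [← hcard]
  refine Finset.card_le_mul_card_image_of_maps_to (f := fun x i => x i.1)
    (fun _ _ => Finset.mem_univ _) 2 fun y _ => ?_
  refine le_trans (Finset.card_le_card_of_injOn (fun x => x i₀)
    (t := Finset.univ.filter fun t : ZMod p => t ^ 2 = -(y ⬝ᵥ y + k)) ?_ ?_)
    (card_filter_sq_eq_le_two _)
  · intro x hx
    obtain ⟨hquad, rfl⟩ := Finset.mem_filter.1 (Finset.mem_coe.1 hx)
    rw [mem_quadric, dotProduct, Fintype.sum_eq_add_sum_subtype_ne _ i₀] at hquad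
    rw [Finset.mem_coe, Finset.mem_filter_univ, dotProduct]
    linear_combination hquad
  · intro x hx x' hx' h
    have hy := (Finset.mem_filter.1 hx).2.trans (Finset.mem_filter.1 hx').2.symm
    funext i
    by_cases hi : i = i₀
    · exact hi ▸ h
    · exact congrFun hy ⟨i, hi⟩

section Prime

variable {p : ℕ} [Fact p.Prime]

theorem card_critSystem_le_of_eq_zero [Nonempty ι] (hp2 : (2 : ZMod p) ≠ 0)
    (hu : ∀ i, (u i : ZMod p) = 0) :
    (critSystem p k u).card ≤ 2 * p ^ (Fintype.card ι - 1) + p := by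
  have hsub : critSystem p k u ⊆
      (quadric ι p k).image (·, 0) ∪ (Finset.univ : Finset (ZMod p)).image (0, ·) := by
    rintro ⟨x, t⟩ hv
    simp only [mem_critSystem, hu, add_zero, mul_eq_zero, hp2, false_or] at hv
    simp only [Finset.mem_union, Finset.mem_image, mem_quadric, Finset.mem_univ, true_and,
      Prod.mk.injEq]
    by_cases ht : t = 0
    · exact Or.inl ⟨x, hv.1, rfl, ht.symm⟩
    · exact Or.inr ⟨t, funext fun i => ((hv.2 i).resolve_left ht).symm, rfl⟩
  calc (critSystem p k u).card
      ≤ ((quadric ι p k).image (·, 0)).card +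
          ((Finset.univ : Finset (ZMod p)).image ((0 : ι → ZMod p), ·)).card :=
        (Finset.card_le_card hsub).trans (Finset.card_union_le _ _)
    _ ≤ (quadric ι p k).card + (Finset.univ : Finset (ZMod p)).card :=
        Nat.add_le_add Finset.card_image_le Finset.card_image_le
    _ ≤ _ := by
        rw [Finset.card_univ, ZMod.card]
        exact Nat.add_le_add_right (card_quadric_prime_le k) p

theorem injOn_snd_critSystem (hp2 : (2 : ZMod p) ≠ 0) (hu : ∃ i, (u i : ZMod p) ≠ 0) :
    Set.InjOn Prod.snd (critSystem p k u : Set ((ι → ZMod p) × ZMod p)) := by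
  obtain ⟨j, hj⟩ := hu
  rintro ⟨x, t⟩ hx ⟨y, s⟩ hy (rfl : t = s)
  rw [Finset.mem_coe, mem_critSystem] at hx hy
  have ht : t ≠ 0 := by
    rintro rfl
    exact hj (by simpa using hx.2 j)
  refine Prod.ext (funext fun i => mul_left_cancel₀ (mul_ne_zero hp2 ht) ?_) rfl
  linear_combination hx.2 i - hy.2 i

theorem card_critSystem_le_two (hp2 : (2 : ZMod p) ≠ 0)
    (hu : ∑ i, (u i : ZMod p) ^ 2 ≠ 0) : (critSystem p k u).card ≤ 2 := by
  have hrel : ∀ v ∈ critSystem p k u, 4 * (k : ZMod p) * v.2 ^ 2 = -∑ i, (u i : ZMod p) ^ 2 := by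
    rintro ⟨x, t⟩ hv
    obtain ⟨hx, hu⟩ := mem_critSystem.1 hv
    have hsq : ∑ i, (u i : ZMod p) ^ 2 = 4 * t ^ 2 * (x ⬝ᵥ x) := by
      rw [dotProduct, Finset.mul_sum]
      exact Finset.sum_congr rfl fun i _ => by
        linear_combination ((u i : ZMod p) - 2 * t * x i) * hu i
    linear_combination 4 * t ^ 2 * hx + hsq
  have hne : ∃ i, (u i : ZMod p) ≠ 0 := by
    by_contra! h
    exact hu (Finset.sum_eq_zero fun i _ => by rw [h i, zero_pow two_ne_zero])
  refine le_trans (Finset.card_le_card_of_injOn Prod.snd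
    (t := Finset.univ.filter fun t : ZMod p => t ^ 2 = (-∑ i, (u i : ZMod p) ^ 2) / (4 * k))
    (fun v hv => ?_) (injOn_snd_critSystem hp2 hne)) (card_filter_sq_eq_le_two _)
  have hk : 4 * (k : ZMod p) ≠ 0 := by
    intro h0
    exact hu (neg_eq_zero.1 (by rw [← hrel v hv, h0, zero_mul]))
  rw [Finset.mem_coe, Finset.mem_filter_univ, eq_div_iff hk, mul_comm, hrel v hv]

theorem card_critSystem_prime_le (hι : 2 ≤ Fintype.card ι) (k : ℤ) (u : ι → ℤ) :
    (critSystem p k u).card ≤ 2 ^ (Fintype.card ι + 1) * Nat.gcd p (∑ i, (u i).natAbs ^ 2) *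
      Nat.gcd p (Finset.univ.gcd fun i => (u i).natAbs) ^ (Fintype.card ι - 2) := by
  have hp : p.Prime := Fact.out
  have : Nonempty ι := Fintype.card_pos_iff.1 (by lia)
  obtain ⟨n, hn⟩ := Nat.exists_eq_add_of_le' hι
  have hn1 : Fintype.card ι - 1 = n + 1 := by lia
  have hn2 : Fintype.card ι - 2 = n := by lia
  have hg1 : 1 ≤ Nat.gcd p (∑ i, (u i).natAbs ^ 2) := Nat.gcd_pos_of_pos_left _ hp.pos
  have hg2 : 1 ≤ Nat.gcd p (Finset.univ.gcd fun i => (u i).natAbs) ^ (Fintype.card ι - 2) :=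
    Nat.one_le_pow _ _ (Nat.gcd_pos_of_pos_left _ hp.pos)
  have h8 : 8 ≤ 2 ^ (Fintype.card ι + 1) := by
    calc 8 = 2 ^ 3 := rfl
      _ ≤ _ := Nat.pow_le_pow_right two_pos (by lia)
  have hsq := sum_intCast_sq_eq_zero_iff_dvd p u
  by_cases hp2 : (2 : ZMod p) = 0
  · obtain rfl : p = 2 := (Nat.prime_dvd_prime_iff_eq hp Nat.prime_two).1
      ((ZMod.natCast_eq_zero_iff 2 p).1 (by exact_mod_cast hp2))
    calc (critSystem 2 k u).card ≤ 2 ^ (Fintype.card ι + 1) * 1 * 1 :=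
          (Finset.card_le_univ _).trans (by simp [pow_succ])
      _ ≤ _ := by gcongr
  by_cases h0 : ∀ i, (u i : ZMod p) = 0
  · have hc : p ∣ Finset.univ.gcd fun i => (u i).natAbs := Finset.dvd_gcd fun i _ => by
      rw [← Int.natCast_dvd, ← ZMod.intCast_zmod_eq_zero_iff_dvd, h0]
    rw [Nat.gcd_eq_left (hsq.1 (Finset.sum_eq_zero fun i _ => by simp [h0])), Nat.gcd_eq_left hc]
    have hcrit := card_critSystem_le_of_eq_zero (k := k) hp2 h0
    have hpn : p ≤ p ^ (n + 1) := Nat.le_self_pow n.succ_ne_zero p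
    rw [hn1] at hcrit
    rw [hn2, mul_assoc, ← pow_succ']
    nlinarith
  push Not at h0
  by_cases hn : ∑ i, (u i : ZMod p) ^ 2 = 0
  · rw [Nat.gcd_eq_left (hsq.1 hn)]
    calc (critSystem p k u).card ≤ (Finset.univ : Finset (ZMod p)).card :=
          Finset.card_le_card_of_injOn _ (fun _ _ => by simp) (injOn_snd_critSystem hp2 h0)
      _ = 1 * p * 1 := by rw [Finset.card_univ, ZMod.card, one_mul, mul_one]
      _ ≤ _ := by gcongr; lia
  · calc (critSystem p k u).card ≤ 8 * 1 * 1 := (card_critSystem_le_two hp2 hn).trans (by norm_num)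
      _ ≤ _ := by gcongr

end Prime

theorem card_critSystem_le (hι : 2 ≤ Fintype.card ι) {d : ℕ} [hd : NeZero d] (hsf : Squarefree d)
    (k : ℤ) (u : ι → ℤ) :
    (critSystem d k u).card ≤
      d.divisors.card ^ (Fintype.card ι + 1) * Nat.gcd d (∑ i, (u i).natAbs ^ 2) *
        Nat.gcd d (Finset.univ.gcd fun i => (u i).natAbs) ^ (Fintype.card ι - 2) := by
  revert hd hsf
  induction d using induction_on_primes with
  | zero =>
    intro hd _
    exact absurd rfl hd.out
  | one =>
    intro _ _
    refine (Finset.card_le_univ _).trans ?_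
    simp
  | prime_mul p m hp ih =>
    intro hd hsf
    have : NeZero m := ⟨right_ne_zero_of_mul hd.out⟩
    have : Fact p.Prime := ⟨hp⟩
    have hcop : Nat.Coprime p m := Nat.coprime_of_squarefree_mul hsf
    have hτ : (p * m).divisors.card = 2 * m.divisors.card := by
      rw [Nat.Coprime.card_divisors_mul hcop, hp.divisors, Finset.card_pair hp.one_lt.ne]
    have hgcd : ∀ n, Nat.gcd (p * m) n = Nat.gcd p n * Nat.gcd m n := fun n => by
      rw [Nat.gcd_comm, hcop.gcd_mul, Nat.gcd_comm, Nat.gcd_comm n m]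
    refine (card_critSystem_mul_le hcop k u).trans ((Nat.mul_le_mul
      (card_critSystem_prime_le hι k u) (ih hsf.of_mul_right)).trans (le_of_eq ?_))
    rw [hτ, hgcd, hgcd]
    ring

end CriticalSystem

section ExponentialSums

open ZMod

theorem addChar_sum_eq_prod {A M ι : Type*} [AddCommMonoid A] [CommMonoid M] (ψ : AddChar A M)
    (s : Finset ι) (f : ι → A) : ψ (∑ i ∈ s, f i) = ∏ i ∈ s, ψ (f i) :=
  map_prod ψ.toMonoidHom (fun i => Multiplicative.ofAdd (f i)) s

theorem sum_stdAddChar_mul (q : ℕ) [NeZero q] (b : ZMod q) :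
    ∑ x : ZMod q, stdAddChar (x * b) = if b = 0 then (q : ℂ) else 0 := by
  rw [AddChar.sum_mulShift b (isPrimitive_stdAddChar q), ZMod.card, Nat.cast_ite, Nat.cast_zero]

theorem sum_stdAddChar_dotProduct {ι : Type*} [Fintype ι] [DecidableEq ι] (q : ℕ) [NeZero q]
    (w : ι → ZMod q) :
    ∑ x, stdAddChar (x ⬝ᵥ w) = if w = 0 then (q : ℂ) ^ Fintype.card ι else 0 := by
  simp only [dotProduct, addChar_sum_eq_prod]
  rw [← Fintype.prod_sum fun i (v : ZMod q) => (stdAddChar (v * w i) : ℂ)]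
  simp only [sum_stdAddChar_mul, Finset.prod_ite_zero, Finset.prod_const, Finset.card_univ,
    Finset.mem_univ, true_imp_iff, funext_iff, Pi.zero_apply]

section LinearSum

/-- The exponential sum over the interval `[1, N]` with frequency `a / q`. -/
noncomputable def linearSum (q : ℕ) [NeZero q] (N : ℕ) (a : ZMod q) : ℂ :=
  ∑ x ∈ Finset.Icc 1 N, stdAddChar ((x : ZMod q) * a)

variable {q : ℕ} [NeZero q]

theorem norm_linearSum_le (N : ℕ) (a : ZMod q) : ‖linearSum q N a‖ ≤ N := by
  refine (norm_sum_le _ _).trans (le_of_eq ?_)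
  simp only [AddChar.norm_apply, Finset.sum_const, Nat.card_Icc, Nat.add_sub_cancel,
    nsmul_eq_mul, mul_one]

theorem mul_linearSum (N : ℕ) (a : ZMod q) :
    (stdAddChar a - 1) * linearSum q N a = stdAddChar a ^ (N + 1) - stdAddChar a := by
  have hpow : linearSum q N a = ∑ x ∈ Finset.Ico 1 (N + 1), stdAddChar a ^ x := by
    refine Finset.sum_congr rfl fun x _ => ?_
    rw [← AddChar.map_nsmul_eq_pow, nsmul_eq_mul]
  rw [hpow, mul_comm, geom_sum_Ico_mul _ (by lia), pow_one]

theorem four_mul_valMinAbs_div_le_norm_stdAddChar_sub_one (a : ZMod q) :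
    4 * (a.valMinAbs.natAbs : ℝ) / q ≤ ‖(stdAddChar a : ℂ) - 1‖ := by
  set j : ℝ := (a.valMinAbs.natAbs : ℝ) with hj_def
  have hq0 : (0 : ℝ) < q := by exact_mod_cast Nat.pos_of_ne_zero (NeZero.ne q)
  have hj : j * 2 ≤ q := by
    rw [hj_def]
    exact_mod_cast (Nat.le_div_iff_mul_le two_pos).1 a.natAbs_valMinAbs_le
  have hangle : Real.pi * j / q ≤ Real.pi / 2 := by
    rw [div_le_div_iff₀ hq0 two_pos, mul_assoc]
    exact mul_le_mul_of_nonneg_left hj Real.pi_pos.le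
  have hexp : stdAddChar a =
      Complex.exp (Complex.I * ((2 * Real.pi * a.valMinAbs / q : ℝ) : ℂ)) := by
    conv_lhs => rw [← coe_valMinAbs a, stdAddChar_coe]
    push_cast
    ring_nf
  have hsin : ‖(stdAddChar a : ℂ) - 1‖ = 2 * |Real.sin (Real.pi * j / q)| := by
    rw [hexp, Complex.norm_exp_I_mul_ofReal_sub_one, Real.norm_eq_abs, abs_mul, abs_two]
    have hj' : j = |(a.valMinAbs : ℝ)| := by rw [← Int.cast_abs, ← Nat.cast_natAbs]
    rcases abs_choice (a.valMinAbs : ℝ) with h | h <;> rw [hj', h]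
    · ring_nf
    · rw [mul_neg, neg_div, Real.sin_neg, abs_neg]
      ring_nf
  calc 4 * j / q = 2 * (2 / Real.pi * (Real.pi * j / q)) := by field_simp; ring
    _ ≤ 2 * |Real.sin (Real.pi * j / q)| := by
        gcongr
        exact (Real.mul_le_sin (by positivity) hangle).trans (le_abs_self _)
    _ = _ := hsin.symm

theorem norm_linearSum_le_div (N : ℕ) {a : ZMod q} (ha : a ≠ 0) :
    ‖linearSum q N a‖ ≤ q / a.valMinAbs.natAbs := by
  have hj : (0 : ℝ) < a.valMinAbs.natAbs := by
    exact_mod_cast Int.natAbs_pos.2 ((valMinAbs_eq_zero a).not.2 ha)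
  have hq : (0 : ℝ) < q := by exact_mod_cast Nat.pos_of_ne_zero (NeZero.ne q)
  have hmul : 4 * (a.valMinAbs.natAbs : ℝ) / q * ‖linearSum q N a‖ ≤ 2 := calc
    _ ≤ ‖(stdAddChar a : ℂ) - 1‖ * ‖linearSum q N a‖ :=
        mul_le_mul_of_nonneg_right (four_mul_valMinAbs_div_le_norm_stdAddChar_sub_one a)
          (norm_nonneg _)
    _ = ‖stdAddChar a ^ (N + 1) - stdAddChar a‖ := by rw [← norm_mul, mul_linearSum]
    _ ≤ ‖stdAddChar a ^ (N + 1)‖ + ‖(stdAddChar a : ℂ)‖ := norm_sub_le _ _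
    _ = 2 := by rw [norm_pow, AddChar.norm_apply, one_pow, one_add_one_eq_two]
  rw [le_div_iff₀ hj]
  rw [div_mul_eq_mul_div, div_le_iff₀ hq] at hmul
  linarith

end LinearSum

variable {ι : Type*} [Fintype ι] [DecidableEq ι]

/-- The exponential sum over the points of the quadric modulo `q` with frequency vector `u / q`. -/
noncomputable def quadricSum (q : ℕ) [NeZero q] (k : ℤ) (u : ι → ZMod q) : ℂ :=
  ∑ x ∈ quadric ι q k, stdAddChar (x ⬝ᵥ u)

/-- The value `∑ i, x i ^ 2 + k` of the inhomogeneous quadratic form whose square-free values are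
counted. -/
def sumSqAdd {ι : Type*} [Fintype ι] (k : ℤ) (x : ι → ℕ) : ℤ := ∑ i, (x i : ℤ) ^ 2 + k

/-- The box of vectors with entries in `[1, N]`. -/
def box (ι : Type*) [Fintype ι] [DecidableEq ι] (N : ℕ) : Finset (ι → ℕ) :=
  Fintype.piFinset fun _ => Finset.Icc 1 N

/-- The number of vectors in the box of side `N` whose reduction modulo `q` is on the quadric. -/
def boxCount (ι : Type*) [Fintype ι] [DecidableEq ι] (q N : ℕ) (k : ℤ) : ℕ :=
  {x ∈ box ι N | (q : ℤ) ∣ sumSqAdd k x}.card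

omit [DecidableEq ι] in
theorem sumSqAdd_eq_natCast_add (k : ℤ) (x : ι → ℕ) :
    sumSqAdd k x = ((∑ i, x i ^ 2 : ℕ) : ℤ) + k := by
  simp [sumSqAdd]

theorem mem_box {N : ℕ} {x : ι → ℕ} : x ∈ box ι N ↔ ∀ i, 1 ≤ x i ∧ x i ≤ N := by
  simp [box]

theorem quadricSum_zero (q : ℕ) [NeZero q] (k : ℤ) :
    quadricSum q k (0 : ι → ZMod q) = (quadric ι q k).card := by
  simp [quadricSum]

section Completion

variable {q : ℕ} [NeZero q]

theorem natCast_mem_quadric_iff {k : ℤ} {x : ι → ℕ} :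
    (fun i => (x i : ZMod q)) ∈ quadric ι q k ↔ (q : ℤ) ∣ sumSqAdd k x := by
  rw [mem_quadric, ← intCast_zmod_eq_zero_iff_dvd, sumSqAdd]
  simp [dotProduct, sq]

theorem linearSum_self (a : ZMod q) : linearSum q q a = if a = 0 then (q : ℂ) else 0 := by
  split_ifs with ha
  · simp [linearSum, ha]
  · have hne : (stdAddChar a : ℂ) - 1 ≠ 0 := by
      rw [sub_ne_zero, ← AddChar.map_zero_eq_one (stdAddChar : AddChar (ZMod q) ℂ)]
      exact fun h => ha (injective_stdAddChar h)
    refine (mul_eq_zero.1 ((mul_linearSum q a).trans ?_)).resolve_left hne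
    rw [pow_succ, ← AddChar.map_nsmul_eq_pow, nsmul_eq_mul, natCast_self, zero_mul,
      AddChar.map_zero_eq_one, one_mul, sub_self]

theorem prod_linearSum_neg (N : ℕ) (u : ι → ZMod q) :
    ∏ i, linearSum q N (-u i) =
      ∑ x ∈ box ι N, stdAddChar (-((fun i => (x i : ZMod q)) ⬝ᵥ u)) := by
  simp only [box, linearSum, Finset.prod_univ_sum, dotProduct, ← Finset.sum_neg_distrib, ← mul_neg,
    addChar_sum_eq_prod]

theorem boxCount_completion (q : ℕ) [NeZero q] (N : ℕ) (k : ℤ) :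
    (q : ℂ) ^ Fintype.card ι * boxCount ι q N k =
      ∑ u : ι → ZMod q, quadricSum q k u * ∏ i, linearSum q N (-u i) := by
  have hterm : ∀ (x : ι → ℕ) (u : ι → ZMod q),
      quadricSum q k u * stdAddChar (-((fun i => (x i : ZMod q)) ⬝ᵥ u)) =
        ∑ v ∈ quadric ι q k, stdAddChar (u ⬝ᵥ (v - fun i => (x i : ZMod q))) := fun x u => by
    rw [quadricSum, Finset.sum_mul]
    refine Finset.sum_congr rfl fun v _ => ?_
    rw [← AddChar.map_add_eq_mul, dotProduct_sub, dotProduct_comm u, dotProduct_comm u,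
      sub_eq_add_neg]
  have hsum : ∀ x : ι → ℕ,
      ∑ u, quadricSum q k u * stdAddChar (-((fun i => (x i : ZMod q)) ⬝ᵥ u)) =
        if (q : ℤ) ∣ sumSqAdd k x then (q : ℂ) ^ Fintype.card ι else 0 := fun x => by
    simp only [hterm]
    rw [Finset.sum_comm]
    simp only [sum_stdAddChar_dotProduct, sub_eq_zero, Finset.sum_ite_eq', natCast_mem_quadric_iff]
  simp only [prod_linearSum_neg, Finset.mul_sum]
  rw [Finset.sum_comm]
  simp only [hsum, boxCount, ← Finset.sum_filter, Finset.sum_const, nsmul_eq_mul]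
  exact mul_comm _ _

theorem card_quadric_eq_boxCount (k : ℤ) : (quadric ι q k).card = boxCount ι q q k := by
  have hq : (q : ℂ) ^ Fintype.card ι ≠ 0 := pow_ne_zero _ (Nat.cast_ne_zero.2 (NeZero.ne q))
  have hprod : ∀ u : ι → ZMod q,
      ∏ i, linearSum q q (-u i) = if u = 0 then (q : ℂ) ^ Fintype.card ι else 0 := fun u => by
    simp only [linearSum_self, neg_eq_zero, Finset.prod_ite_zero, Finset.prod_const,
      Finset.card_univ, Finset.mem_univ, true_imp_iff, funext_iff, Pi.zero_apply]
  have hcomp := boxCount_completion (ι := ι) q q k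
  simp only [hprod, mul_ite, mul_zero, Finset.sum_ite_eq', Finset.mem_univ, if_true,
    quadricSum_zero] at hcomp
  exact_mod_cast (mul_left_cancel₀ hq (hcomp.trans (mul_comm _ _))).symm

end Completion

section Shift

/- Averaging over the shifts `σ h` inserts the factor `∑ h, χ g h`, which removes every `g`
outside `s`. -/
theorem norm_sum_le_card_of_shift {G : Type*} [AddGroup G] [Fintype G] {f : G → ℂ}
    (hf : ∀ g, ‖f g‖ = 1) (σ : G → G) {χ : G → G → ℂ} (hχ : ∀ g h, ‖χ g h‖ = 1)
    (hshift : ∀ g h, f (g + σ h) = f g * χ g h) {s : Finset G}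
    (hs : ∀ g ∉ s, ∑ h, χ g h = 0) : ‖∑ g, f g‖ ≤ s.card := by
  have hG : (0 : ℝ) < Fintype.card G := by exact_mod_cast Fintype.card_pos
  have havg : (Fintype.card G : ℂ) * ∑ g, f g = ∑ g ∈ s, f g * ∑ h, χ g h := by
    calc (Fintype.card G : ℂ) * ∑ g, f g = ∑ h : G, ∑ g, f (g + σ h) := by
          have hinv (h : G) : ∑ g, f (g + σ h) = ∑ g, f g :=
            Fintype.sum_equiv (Equiv.addRight (σ h)) _ _ fun _ => rfl
          simp only [hinv, Finset.sum_const, Finset.card_univ, nsmul_eq_mul]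
      _ = ∑ g, f g * ∑ h, χ g h := by
          rw [Finset.sum_comm]
          simp only [hshift, Finset.mul_sum]
      _ = _ := by
          refine (Finset.sum_subset (Finset.subset_univ s) fun _ _ hg => ?_).symm
          rw [hs _ hg, mul_zero]
  refine le_of_mul_le_mul_left ?_ hG
  calc (Fintype.card G : ℝ) * ‖∑ g, f g‖ = ‖(Fintype.card G : ℂ) * ∑ g, f g‖ := by
        rw [norm_mul, Complex.norm_natCast]
    _ ≤ ∑ g ∈ s, ‖f g * ∑ h, χ g h‖ := by rw [havg]; exact norm_sum_le _ _
    _ ≤ ∑ _g ∈ s, (Fintype.card G : ℝ) := by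
        refine Finset.sum_le_sum fun g _ => ?_
        rw [norm_mul, hf, one_mul]
        refine (norm_sum_le _ _).trans (le_of_eq ?_)
        simp only [hχ, Finset.sum_const, Finset.card_univ, nsmul_eq_mul, mul_one]
    _ = _ := by rw [Finset.sum_const, nsmul_eq_mul, mul_comm]

section Phase

variable {R : Type*} [CommRing R]

/-- The phase `t * (x ⬝ᵥ x + k) + x ⬝ᵥ u` at `g = (x, t)`; summing its additive character over `t`
detects the quadric. -/
def phase (k : R) (u : ι → R) (g : (ι → R) × R) : R := g.2 * (g.1 ⬝ᵥ g.1 + k) + g.1 ⬝ᵥ u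

omit [DecidableEq ι] in
theorem phase_add_smul {c : R} (hc : c * c = 0) (k : R) (u : ι → R) (g h : (ι → R) × R) :
    phase k u (g + c • h) = phase k u g +
      (h.1 ⬝ᵥ (fun i => c * (2 * g.2 * g.1 i + u i)) + h.2 * (c * (g.1 ⬝ᵥ g.1 + k))) := by
  obtain ⟨x, t⟩ := g
  obtain ⟨y, s⟩ := h
  have hgrad : y ⬝ᵥ (fun i => c * (2 * t * x i + u i)) = c * (2 * t * (x ⬝ᵥ y) + y ⬝ᵥ u) := by
    simp only [dotProduct, Finset.mul_sum, ← Finset.sum_add_distrib]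
    exact Finset.sum_congr rfl fun i _ => by ring
  simp only [phase, hgrad, Prod.smul_mk, Prod.mk_add_mk, add_dotProduct, dotProduct_add,
    smul_dotProduct, dotProduct_smul, smul_eq_mul, dotProduct_comm y x]
  linear_combination (t * (y ⬝ᵥ y) + s * (2 * (x ⬝ᵥ y)) + c * s * (y ⬝ᵥ y)) * hc

theorem sum_stdAddChar_phase (q : ℕ) [NeZero q] (k : ℤ) (u : ι → ZMod q) :
    ∑ g, stdAddChar (phase (k : ZMod q) u g) = q * quadricSum q k u := by
  rw [Fintype.sum_prod_type, quadricSum, quadric, Finset.sum_filter, Finset.mul_sum]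
  refine Finset.sum_congr rfl fun x _ => ?_
  simp only [phase, AddChar.map_add_eq_mul, ← Finset.sum_mul, sum_stdAddChar_mul, ite_mul,
    zero_mul, mul_ite, mul_zero]

end Phase

variable {d : ℕ} [NeZero d]

theorem card_filter_castHom_eq_le (r : ZMod d) :
    (Finset.univ.filter fun x : ZMod (d ^ 2) =>
      castHom (dvd_pow_self d two_ne_zero) (ZMod d) x = r).card ≤ d := by
  have hval : ∀ x : ZMod (d ^ 2), castHom (dvd_pow_self d two_ne_zero) (ZMod d) x = r →
      x.val % d = r.val := by
    rintro x rfl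
    rw [castHom_apply, cast_eq_val, val_natCast]
  conv_rhs => rw [← Finset.card_range d]
  refine Finset.card_le_card_of_injOn (fun x => x.val / d) (fun x _ => ?_) fun x hx y hy h => ?_
  · have : x.val < d * d := (val_lt x).trans_eq (sq d)
    exact Finset.mem_coe.2 (Finset.mem_range.2 (Nat.div_lt_of_lt_mul this))
  · have hmod := (hval x (Finset.mem_filter.1 hx).2).trans (hval y (Finset.mem_filter.1 hy).2).symm
    exact val_injective _ (Nat.ext_div_mod h hmod)

theorem castHom_eq_zero_of_natCast_mul_eq_zero {x : ZMod (d ^ 2)}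
    (h : (d : ZMod (d ^ 2)) * x = 0) :
    castHom (dvd_pow_self d two_ne_zero) (ZMod d) x = 0 := by
  rw [← natCast_zmod_val x, ← Nat.cast_mul, natCast_eq_zero_iff] at h
  rw [castHom_apply, cast_eq_val, natCast_eq_zero_iff]
  exact Nat.dvd_of_mul_dvd_mul_left (Nat.pos_of_ne_zero (NeZero.ne d)) ((sq d).symm.dvd.trans h)

/-- The points `(x, t)` modulo `d ^ 2` at which the phase `t * (x ⬝ᵥ x + k) + x ⬝ᵥ u` is
stationary under shifts of `(x, t)` by multiples of `d`. -/
def stationarySet (d : ℕ) [NeZero d] (k : ℤ) (u : ι → ℤ) :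
    Finset ((ι → ZMod (d ^ 2)) × ZMod (d ^ 2)) :=
  {g | (d : ZMod (d ^ 2)) * (g.1 ⬝ᵥ g.1 + k) = 0 ∧
    ∀ i, (d : ZMod (d ^ 2)) * (2 * g.2 * g.1 i + u i) = 0}

theorem card_stationarySet_le (k : ℤ) (u : ι → ℤ) :
    (stationarySet d k u).card ≤ d ^ (Fintype.card ι + 1) * (critSystem d k u).card := by
  set φ := castHom (dvd_pow_self d two_ne_zero) (ZMod d) with hφ
  refine Finset.card_le_mul_card_image_of_maps_to (f := fun g => (φ ∘ g.1, φ g.2)) ?_ _ ?_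
  · rintro ⟨x, t⟩ hg
    obtain ⟨hx, hu⟩ := (Finset.mem_filter_univ _).1 hg
    refine mem_critSystem.2 ⟨?_, fun i => ?_⟩
    · simpa only [map_add, map_intCast, RingHom.map_dotProduct] using
        castHom_eq_zero_of_natCast_mul_eq_zero hx
    · simpa only [map_add, map_mul, map_intCast, map_ofNat, Function.comp_apply] using
        castHom_eq_zero_of_natCast_mul_eq_zero (hu i)
  · rintro ⟨y, s⟩ -
    let T := fun r : ZMod d => Finset.univ.filter fun x : ZMod (d ^ 2) => φ x = r
    calc _ ≤ ((Fintype.piFinset fun i => T (y i)) ×ˢ T s).card := by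
          refine Finset.card_le_card fun ⟨x, t⟩ hg => ?_
          obtain ⟨hx, ht⟩ := Prod.mk.inj (Finset.mem_filter.1 hg).2
          simp only [Finset.mem_product, Fintype.mem_piFinset, T, Finset.mem_filter_univ]
          exact ⟨fun i => congrFun hx i, ht⟩
      _ = (∏ i, (T (y i)).card) * (T s).card := by
          rw [Finset.card_product, Fintype.card_piFinset]
      _ ≤ (∏ _i : ι, d) * d := by
          gcongr <;> exact card_filter_castHom_eq_le _
      _ = d ^ (Fintype.card ι + 1) := by
          rw [Finset.prod_const, Finset.card_univ, pow_succ]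

theorem natCast_mul_self_eq_zero (d : ℕ) : (d : ZMod (d ^ 2)) * d = 0 := by
  rw [← sq, ← Nat.cast_pow, natCast_self]

theorem norm_quadricSum_le (k : ℤ) (u : ι → ℤ) :
    (d : ℝ) ^ 2 * ‖quadricSum (d ^ 2) k fun i => (u i : ZMod (d ^ 2))‖ ≤
      d ^ (Fintype.card ι + 1) * (critSystem d k u).card := by
  have hnorm := norm_sum_le_card_of_shift (s := stationarySet d k u)
    (f := fun g => stdAddChar (phase (k : ZMod (d ^ 2)) (fun i => (u i : ZMod (d ^ 2))) g))
    (χ := fun g h : (ι → ZMod (d ^ 2)) × ZMod (d ^ 2) => stdAddChar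
      (h.1 ⬝ᵥ (fun i => (d : ZMod (d ^ 2)) * (2 * g.2 * g.1 i + u i)) +
        h.2 * ((d : ZMod (d ^ 2)) * (g.1 ⬝ᵥ g.1 + (k : ZMod (d ^ 2))))))
    (fun _ => AddChar.norm_apply _ _) ((d : ZMod (d ^ 2)) • ·)
    (fun _ _ => AddChar.norm_apply _ _)
    (fun g h => by rw [phase_add_smul (natCast_mul_self_eq_zero d), AddChar.map_add_eq_mul])
    fun g hg => by
      simp only [AddChar.map_add_eq_mul, Fintype.sum_prod_type, ← Finset.sum_mul_sum,
        sum_stdAddChar_dotProduct, sum_stdAddChar_mul, funext_iff, Pi.zero_apply]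
      rw [stationarySet, Finset.mem_filter_univ, not_and_or] at hg
      rcases hg with h | h
      · rw [if_neg h, mul_zero]
      · rw [if_neg h, zero_mul]
  rw [sum_stdAddChar_phase, norm_mul, Complex.norm_natCast, Nat.cast_pow] at hnorm
  exact hnorm.trans (by exact_mod_cast card_stationarySet_le k u)

end Shift

end ExponentialSums

section FrequencySums

/-- The bound for the linear exponential sum over `[1, N]` modulo `d ^ 2` at a frequency whose
least absolute residue is `± m`. -/
noncomputable def freqWeight (d N m : ℕ) : ℝ := if m = 0 then (N : ℝ) else (d : ℝ) ^ 2 / m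

theorem freqWeight_nonneg (d N m : ℕ) : 0 ≤ freqWeight d N m := by
  unfold freqWeight
  split_ifs <;> positivity

theorem freqWeight_mono_left {d D : ℕ} (h : d ≤ D) (N m : ℕ) :
    freqWeight d N m ≤ freqWeight D N m := by
  unfold freqWeight
  split_ifs
  · exact le_rfl
  · gcongr

theorem freqWeight_zero (d N : ℕ) : freqWeight d N 0 = N := if_pos rfl

theorem freqWeight_of_ne_zero (d N : ℕ) {m : ℕ} (hm : m ≠ 0) :
    freqWeight d N m = (d : ℝ) ^ 2 / m :=
  if_neg hm

theorem norm_linearSum_neg_le (d : ℕ) [NeZero d] (N : ℕ) (a : ZMod (d ^ 2)) :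
    ‖linearSum (d ^ 2) N (-a)‖ ≤ freqWeight d N a.valMinAbs.natAbs := by
  unfold freqWeight
  split_ifs with h
  · exact norm_linearSum_le _ _
  · have ha : -a ≠ 0 := neg_ne_zero.2 fun h0 => h (by rw [h0, ZMod.valMinAbs_zero, Int.natAbs_zero])
    simpa only [ZMod.natAbs_valMinAbs_neg, Nat.cast_pow] using norm_linearSum_le_div N ha

section General

variable {ι : Type*} [Fintype ι] [DecidableEq ι]

/-- The bound, up to divisor functions and powers of `d`, for the contribution to the box count
modulo `d ^ 2` of a frequency vector whose entries have absolute values `v i`. -/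
noncomputable def vectorWeight (d N : ℕ) (v : ι → ℕ) : ℝ :=
  Nat.gcd d (∑ i, v i ^ 2) * (Nat.gcd d (Finset.univ.gcd v) : ℝ) ^ (Fintype.card ι - 2) *
    ∏ i, freqWeight d N (v i)

/-- The deviation of the number of points of the quadric modulo `d ^ 2` in `[1, N]` from its
expected value, the density of the quadric times the volume of the box. -/
noncomputable def boxError (ι : Type*) [Fintype ι] [DecidableEq ι] (d N : ℕ) (k : ℤ) : ℝ :=
  boxCount ι (d ^ 2) N k -
    boxCount ι (d ^ 2) (d ^ 2) k * (N : ℝ) ^ Fintype.card ι / (d : ℝ) ^ (2 * Fintype.card ι)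

omit [DecidableEq ι] in
theorem vectorWeight_nonneg (d N : ℕ) (v : ι → ℕ) : 0 ≤ vectorWeight d N v :=
  mul_nonneg (by positivity) (Finset.prod_nonneg fun _ _ => freqWeight_nonneg _ _ _)

omit [DecidableEq ι] in
theorem vectorWeight_comp_equiv (d N : ℕ) (v : ι → ℕ) (σ : Equiv.Perm ι) :
    vectorWeight d N (v ∘ σ) = vectorWeight d N v := by
  have hgcd : Finset.univ.gcd (v ∘ σ) = Finset.univ.gcd v := by
    refine Nat.dvd_antisymm (Finset.dvd_gcd fun i _ => ?_) (Finset.dvd_gcd fun i _ => ?_)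
    · simpa using Finset.gcd_dvd (f := v ∘ σ) (Finset.mem_univ (σ.symm i))
    · exact Finset.gcd_dvd (Finset.mem_univ (σ i))
  simp only [vectorWeight, hgcd, Function.comp_apply, Equiv.sum_comp σ fun i => v i ^ 2,
    Equiv.prod_comp σ fun i => freqWeight d N (v i)]

theorem sq_mul_norm_quadricSum_mul_prod_linearSum_le (hι : 2 ≤ Fintype.card ι) {d : ℕ} [NeZero d]
    (hd : Squarefree d) (N : ℕ) (k : ℤ) (u : ι → ZMod (d ^ 2)) :
    (d : ℝ) ^ 2 * ‖quadricSum (d ^ 2) k u * ∏ i, linearSum (d ^ 2) N (-u i)‖ ≤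
      d ^ (Fintype.card ι + 1) * ((d.divisors.card : ℝ) ^ (Fintype.card ι + 1) *
        vectorWeight d N fun i => (u i).valMinAbs.natAbs) := by
  have hquad := norm_quadricSum_le (d := d) k fun i => (u i).valMinAbs
  simp only [ZMod.coe_valMinAbs] at hquad
  have hcrit := Nat.cast_le (α := ℝ).2 (card_critSystem_le hι hd k fun i => (u i).valMinAbs)
  have hlin : ∏ i, ‖linearSum (d ^ 2) N (-u i)‖ ≤
      ∏ i, freqWeight d N (u i).valMinAbs.natAbs :=
    Finset.prod_le_prod (fun _ _ => norm_nonneg _) fun _ _ => norm_linearSum_neg_le d N _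
  rw [norm_mul, norm_prod, ← mul_assoc]
  refine (mul_le_mul (hquad.trans (mul_le_mul_of_nonneg_left hcrit (by positivity))) hlin
    (by positivity) (by positivity)).trans (le_of_eq ?_)
  unfold vectorWeight
  push_cast
  ring

/- The zero frequency gives the main term of the completed sum. -/
theorem pow_mul_abs_boxError_le (hι : 2 ≤ Fintype.card ι) {d : ℕ} (hd : Squarefree d)
    (N : ℕ) (k : ℤ) [NeZero d] :
    (d : ℝ) ^ (Fintype.card ι + 1) * |boxError ι d N k| ≤
      (d.divisors.card : ℝ) ^ (Fintype.card ι + 1) *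
        ∑ u ∈ (Finset.univ : Finset (ι → ZMod (d ^ 2))).erase 0,
          vectorWeight d N fun i => (u i).valMinAbs.natAbs := by
  set n := Fintype.card ι
  have hd0 : (0 : ℝ) < d := by exact_mod_cast Nat.pos_of_ne_zero (NeZero.ne d)
  set term : (ι → ZMod (d ^ 2)) → ℂ := fun u =>
    quadricSum (d ^ 2) k u * ∏ i, linearSum (d ^ 2) N (-u i) with hterm
  have hzero : term 0 = boxCount ι (d ^ 2) (d ^ 2) k * (N : ℂ) ^ n := by
    have hlin : linearSum (d ^ 2) N (-0) = N := by simp [linearSum]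
    simp only [hterm, quadricSum_zero, card_quadric_eq_boxCount, Pi.zero_apply, hlin,
      Finset.prod_const, Finset.card_univ, n]
  have herror : ((d ^ (2 * n) * boxError ι d N k : ℝ) : ℂ) = ∑ u ∈ Finset.univ.erase 0, term u := by
    have hcomp := boxCount_completion (ι := ι) (d ^ 2) N k
    rw [← Finset.add_sum_erase _ term (Finset.mem_univ 0), hzero, Nat.cast_pow, ← pow_mul] at hcomp
    rw [← sub_eq_iff_eq_add'.2 hcomp, boxError, mul_sub, mul_div_cancel₀ _ (by positivity)]
    push_cast
    rfl
  have hnorm : (d : ℝ) ^ (2 * n) * |boxError ι d N k| ≤ ∑ u ∈ Finset.univ.erase 0, ‖term u‖ := by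
    rw [← abs_of_pos (pow_pos hd0 (2 * n)), ← abs_mul, ← Real.norm_eq_abs, ← Complex.norm_real,
      herror]
    exact norm_sum_le _ _
  refine le_of_mul_le_mul_left ?_ (pow_pos hd0 (n + 1))
  calc (d : ℝ) ^ (n + 1) * (d ^ (n + 1) * |boxError ι d N k|)
      = d ^ 2 * (d ^ (2 * n) * |boxError ι d N k|) := by ring
    _ ≤ ∑ u ∈ Finset.univ.erase 0, (d : ℝ) ^ 2 * ‖term u‖ := by
        rw [← Finset.mul_sum]
        gcongr
    _ ≤ _ := by
        rw [Finset.mul_sum, Finset.mul_sum]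
        exact Finset.sum_le_sum fun u _ =>
          sq_mul_norm_quadricSum_mul_prod_linearSum_le hι hd N k u

theorem card_filter_natAbs_valMinAbs_eq_le (q : ℕ) [NeZero q] (m : ℕ) :
    (Finset.univ.filter fun a : ZMod q => a.valMinAbs.natAbs = m).card ≤ 2 := by
  rcases (Finset.univ.filter fun a : ZMod q => a.valMinAbs.natAbs = m).eq_empty_or_nonempty
    with h | ⟨r, hr⟩
  · rw [h, Finset.card_empty]
    exact zero_le_two
  · refine (Finset.card_le_card (t := {r, -r}) fun t ht => ?_).trans Finset.card_le_two
    rw [Finset.mem_filter_univ] at hr ht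
    rw [Finset.mem_insert, Finset.mem_singleton]
    exact ZMod.natAbs_valMinAbs_eq_natAbs_valMinAbs.1 (ht.trans hr.symm)

theorem sum_natAbs_valMinAbs_le {q Q : ℕ} [NeZero q] (hQ : q ≤ Q) {f : (ι → ℕ) → ℝ}
    (hf : ∀ v, 0 ≤ f v) :
    ∑ u ∈ (Finset.univ : Finset (ι → ZMod q)).erase 0, f (fun i => (u i).valMinAbs.natAbs) ≤
      2 ^ Fintype.card ι *
        ∑ v ∈ (Fintype.piFinset fun _ : ι => Finset.range (Q + 1)).erase 0, f v := by
  set π : (ι → ZMod q) → ι → ℕ := fun u i => (u i).valMinAbs.natAbs with hπ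
  have hmaps : ∀ u ∈ (Finset.univ : Finset (ι → ZMod q)).erase 0,
      π u ∈ (Fintype.piFinset fun _ : ι => Finset.range (Q + 1)).erase 0 := fun u hu => by
    refine Finset.mem_erase.2 ⟨fun h => Finset.ne_of_mem_erase hu (funext fun i => ?_), ?_⟩
    · exact (ZMod.valMinAbs_eq_zero _).1 (Int.natAbs_eq_zero.1 (congrFun h i))
    · refine Fintype.mem_piFinset.2 fun i => Finset.mem_range.2 (Nat.lt_succ_of_le ?_)
      exact (ZMod.natAbs_valMinAbs_le _).trans ((Nat.div_le_self _ _).trans hQ)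
  have hfiber : ∀ v : ι → ℕ, (Finset.univ.filter fun u => π u = v).card ≤ 2 ^ Fintype.card ι :=
    fun v => calc
      _ = (Fintype.piFinset fun i =>
            Finset.univ.filter fun a : ZMod q => a.valMinAbs.natAbs = v i).card := by
          congr 1
          ext u
          simp only [Finset.mem_filter_univ, Fintype.mem_piFinset, hπ, funext_iff]
      _ ≤ ∏ _i : ι, 2 := by
          rw [Fintype.card_piFinset]
          exact Finset.prod_le_prod' fun i _ => card_filter_natAbs_valMinAbs_eq_le q (v i)
      _ = _ := by rw [Finset.prod_const, Finset.card_univ]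
  rw [← Finset.sum_fiberwise_of_maps_to hmaps, Finset.mul_sum]
  refine Finset.sum_le_sum fun v _ => ?_
  rw [Finset.sum_congr rfl fun u hu => congrArg f (Finset.mem_filter.1 hu).2, Finset.sum_const,
    nsmul_eq_mul]
  refine mul_le_mul_of_nonneg_right ?_ (hf v)
  exact_mod_cast (Finset.card_le_card
    (Finset.filter_subset_filter _ (Finset.erase_subset _ _))).trans (hfiber v)

end General

section Ternary

theorem sum_piFinset_fin_three {α M : Type*} [AddCommMonoid M] (s : Finset α)
    (f : (Fin 3 → α) → M) :
    ∑ x ∈ Fintype.piFinset fun _ => s, f x = ∑ a ∈ s, ∑ b ∈ s, ∑ c ∈ s, f ![a, b, c] := by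
  simp only [← Finset.sum_product']
  refine Finset.sum_nbij' (fun x => (x 0, x 1, x 2)) (fun t => ![t.1, t.2.1, t.2.2])
    ?_ ?_ ?_ ?_ ?_
  · simp +contextual
  · simp +contextual [Fin.forall_fin_succ]
  · exact fun x _ => List.ofFn_inj.1 rfl
  · exact fun _ _ => rfl
  · exact fun x _ => congrArg f (List.ofFn_inj.1 rfl)

theorem sum_range_succ_eq_add_sum_Icc {M : Type*} [AddCommMonoid M] (f : ℕ → M) (Q : ℕ) :
    ∑ i ∈ Finset.range (Q + 1), f i = f 0 + ∑ i ∈ Finset.Icc 1 Q, f i := by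
  rw [Finset.range_eq_Ico, Finset.sum_eq_sum_Ico_succ_bot (Nat.succ_pos Q)]
  rfl

/- By symmetry, either only the first entry is nonzero or the first two are. -/
theorem sum_erase_zero_le_of_symm {F : (Fin 3 → ℕ) → ℝ} (hF : ∀ v, 0 ≤ F v)
    (hsymm : ∀ v (σ : Equiv.Perm (Fin 3)), F (v ∘ σ) = F v) (Q : ℕ) :
    ∑ v ∈ (Fintype.piFinset fun _ => Finset.range (Q + 1)).erase 0, F v ≤
      3 * (∑ i ∈ Finset.Icc 1 Q, F ![i, 0, 0] +
        ∑ i ∈ Finset.Icc 1 Q, ∑ j ∈ Finset.Icc 1 Q, ∑ l ∈ Finset.range (Q + 1), F ![i, j, l]) := by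
  have hswap₁ : ∀ i j l, F ![i, j, l] = F ![j, i, l] := fun i j l => by
    rw [← hsymm _ (Equiv.swap 0 1)]
    exact congrArg F (List.ofFn_inj.1 rfl)
  have hswap₂ : ∀ i j l, F ![i, j, l] = F ![i, l, j] := fun i j l => by
    rw [← hsymm _ (Equiv.swap 1 2)]
    exact congrArg F (List.ofFn_inj.1 rfl)
  have hzero : (0 : Fin 3 → ℕ) = ![0, 0, 0] := List.ofFn_inj.1 rfl
  have hpos : 0 ≤ ∑ i ∈ Finset.Icc 1 Q, ∑ j ∈ Finset.Icc 1 Q, ∑ l ∈ Finset.Icc 1 Q, F ![i, j, l] :=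
    Finset.sum_nonneg fun _ _ => Finset.sum_nonneg fun _ _ => Finset.sum_nonneg fun _ _ => hF _
  rw [Finset.sum_erase_eq_sub (by simp), sum_piFinset_fin_three, hzero]
  simp only [sum_range_succ_eq_add_sum_Icc, Finset.sum_add_distrib]
  simp only [hswap₂ 0 0, hswap₁ 0, fun i l => hswap₂ i 0 l]
  linarith

theorem natCast_gcd_gcd_univ_le {ι : Type*} [Fintype ι] (d : ℕ) {v : ι → ℕ} {i : ι} (j : ι)
    (hi : v i ≠ 0) : Nat.gcd d (Finset.univ.gcd v) ≤ Nat.gcd (v i) (v j) := by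
  refine Nat.le_of_dvd (Nat.gcd_pos_of_pos_left _ (Nat.pos_of_ne_zero hi))
    ((Nat.gcd_dvd_right _ _).trans (Nat.dvd_gcd ?_ ?_)) <;>
  exact Finset.gcd_dvd (Finset.mem_univ _)

theorem vectorWeight_fin_three (d N i j l : ℕ) :
    vectorWeight d N ![i, j, l] =
      Nat.gcd d (i ^ 2 + j ^ 2 + l ^ 2) * Nat.gcd d (Finset.univ.gcd ![i, j, l]) *
        (freqWeight d N i * freqWeight d N j * freqWeight d N l) := by
  simp [vectorWeight, Fin.sum_univ_three, Fin.prod_univ_three]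

variable (D N : ℕ)

theorem sum_vectorWeight_div_le {i j : ℕ} (hi : i ≠ 0) (hj : j ≠ 0) (l : ℕ) :
    ∑ d ∈ Finset.Icc 1 D, vectorWeight d N ![i, j, l] / (d : ℝ) ^ 4 ≤
      (Nat.gcd i j : ℝ) / (i * j) * freqWeight D N l *
        (D * (i ^ 2 + j ^ 2 + l ^ 2).divisors.card) := by
  have hterm : ∀ d ∈ Finset.Icc 1 D, vectorWeight d N ![i, j, l] / (d : ℝ) ^ 4 ≤
      (Nat.gcd i j : ℝ) / (i * j) * freqWeight D N l * Nat.gcd d (i ^ 2 + j ^ 2 + l ^ 2) := by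
    intro d hd
    obtain ⟨hd1, hd2⟩ := Finset.mem_Icc.1 hd
    have hd0 : (d : ℝ) ≠ 0 := by exact_mod_cast (Nat.one_le_iff_ne_zero.1 hd1)
    have hgcd : (Nat.gcd d (Finset.univ.gcd ![i, j, l]) : ℝ) ≤ Nat.gcd i j :=
      Nat.cast_le.2 (natCast_gcd_gcd_univ_le d (v := ![i, j, l]) (i := 0) 1 hi)
    calc vectorWeight d N ![i, j, l] / (d : ℝ) ^ 4
        = Nat.gcd d (Finset.univ.gcd ![i, j, l]) / (i * j) * freqWeight d N l *
            Nat.gcd d (i ^ 2 + j ^ 2 + l ^ 2) := by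
          rw [vectorWeight_fin_three, freqWeight_of_ne_zero d N hi, freqWeight_of_ne_zero d N hj]
          field_simp
      _ ≤ _ := by
          gcongr
          · exact freqWeight_nonneg _ _ _
          · exact freqWeight_mono_left hd2 N l
  refine (Finset.sum_le_sum hterm).trans ?_
  rw [← Finset.mul_sum]
  have hw := freqWeight_nonneg D N l
  gcongr
  exact_mod_cast sum_gcd_le D (n := i ^ 2 + j ^ 2 + l ^ 2) (by positivity)

theorem sum_vectorWeight_div_le_of_zero {i : ℕ} (hi : i ≠ 0) :
    ∑ d ∈ Finset.Icc 1 D, vectorWeight d N ![i, 0, 0] / (d : ℝ) ^ 4 ≤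
      N ^ 2 * ∑ d ∈ Finset.Icc 1 D, (Nat.gcd d i : ℝ) / (d * i) := by
  rw [Finset.mul_sum]
  refine Finset.sum_le_sum fun d hd => ?_
  have hd1 := (Finset.mem_Icc.1 hd).1
  have hd0 : (d : ℝ) ≠ 0 := by exact_mod_cast (Nat.one_le_iff_ne_zero.1 hd1)
  have hgcd : (Nat.gcd d (Finset.univ.gcd ![i, 0, 0]) : ℝ) ≤ Nat.gcd d i := by
    refine Nat.cast_le.2 (Nat.le_of_dvd (Nat.gcd_pos_of_pos_left _ hd1) ?_)
    exact Nat.gcd_dvd_gcd_of_dvd_right d (Finset.gcd_dvd (f := ![i, 0, 0]) (Finset.mem_univ 0))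
  have hgcd' : (Nat.gcd d (i ^ 2) : ℝ) ≤ d := Nat.cast_le.2 (Nat.gcd_le_left _ hd1)
  calc vectorWeight d N ![i, 0, 0] / (d : ℝ) ^ 4
      = (N : ℝ) ^ 2 *
          (Nat.gcd d (i ^ 2) * Nat.gcd d (Finset.univ.gcd ![i, 0, 0]) / (d ^ 2 * i)) := by
        rw [vectorWeight_fin_three, freqWeight_of_ne_zero d N hi, freqWeight_zero,
          zero_pow two_ne_zero, add_zero, add_zero]
        field_simp
    _ ≤ (N : ℝ) ^ 2 * (d * Nat.gcd d i / (d ^ 2 * i)) := by gcongr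
    _ = (N : ℝ) ^ 2 * (Nat.gcd d i / (d * i)) := by field_simp

theorem sum_sum_vectorWeight_div_le {Q : ℕ} {X : ℝ} (hX : 0 ≤ X)
    (hτ : ∀ n ≠ 0, n ≤ 3 * Q ^ 2 → (n.divisors.card : ℝ) ≤ X)
    (hX' : ∑ i ∈ Finset.Icc 1 Q, (1 : ℝ) / i ≤ X) :
    ∑ i ∈ Finset.Icc 1 Q, ∑ j ∈ Finset.Icc 1 Q, ∑ l ∈ Finset.range (Q + 1),
        ∑ d ∈ Finset.Icc 1 D, vectorWeight d N ![i, j, l] / (d : ℝ) ^ 4 ≤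
      X ^ 3 * (N + D ^ 2 * X) * (D * X) := by
  have hterm : ∀ i ∈ Finset.Icc 1 Q, ∀ j ∈ Finset.Icc 1 Q, ∀ l ∈ Finset.range (Q + 1),
      ∑ d ∈ Finset.Icc 1 D, vectorWeight d N ![i, j, l] / (d : ℝ) ^ 4 ≤
        (Nat.gcd i j : ℝ) / (i * j) * freqWeight D N l * (D * X) := fun i hi j hj l hl => by
    obtain ⟨hi1, hiQ⟩ := Finset.mem_Icc.1 hi
    obtain ⟨hj1, hjQ⟩ := Finset.mem_Icc.1 hj
    have hlQ := Nat.lt_succ_iff.1 (Finset.mem_range.1 hl)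
    refine (sum_vectorWeight_div_le D N (Nat.one_le_iff_ne_zero.1 hi1)
      (Nat.one_le_iff_ne_zero.1 hj1) l).trans ?_
    have hw := freqWeight_nonneg D N l
    have hτ' := hτ (i ^ 2 + j ^ 2 + l ^ 2) (by positivity) <| calc
      _ ≤ Q ^ 2 + Q ^ 2 + Q ^ 2 := by gcongr
      _ = 3 * Q ^ 2 := by ring
    gcongr
  have hfreq : ∑ l ∈ Finset.range (Q + 1), freqWeight D N l ≤ N + D ^ 2 * X := by
    rw [sum_range_succ_eq_add_sum_Icc, freqWeight_zero]
    refine add_le_add_right ((Finset.sum_congr rfl fun l hl => ?_).trans_le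
      ((Finset.mul_sum _ _ _).symm.trans_le (mul_le_mul_of_nonneg_left hX' (by positivity)))) _
    rw [freqWeight_of_ne_zero D N (Nat.one_le_iff_ne_zero.1 (Finset.mem_Icc.1 hl).1),
      mul_one_div]
  have hgcd : ∑ i ∈ Finset.Icc 1 Q, ∑ j ∈ Finset.Icc 1 Q, (Nat.gcd i j : ℝ) / (i * j) ≤ X ^ 3 :=
    sum_gcd_div_mul_le_pow_three le_rfl hX'
  refine (Finset.sum_le_sum fun i hi => Finset.sum_le_sum fun j hj =>
    Finset.sum_le_sum fun l hl => hterm i hi j hj l hl).trans ?_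
  simp only [← Finset.sum_mul, ← Finset.mul_sum]
  gcongr
  exact Finset.sum_nonneg fun l _ => freqWeight_nonneg D N l

theorem sum_erase_zero_vectorWeight_div_le {Q : ℕ} (hDQ : D ≤ Q) {X : ℝ}
    (hτ : ∀ n ≠ 0, n ≤ 3 * Q ^ 2 → (n.divisors.card : ℝ) ≤ X)
    (hX : ∑ i ∈ Finset.Icc 1 Q, (1 : ℝ) / i ≤ X) :
    ∑ v ∈ (Fintype.piFinset fun _ : Fin 3 => Finset.range (Q + 1)).erase 0,
        ∑ d ∈ Finset.Icc 1 D, vectorWeight d N v / (d : ℝ) ^ 4 ≤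
      3 * (N ^ 2 * X ^ 3 + X ^ 3 * (N + D ^ 2 * X) * (D * X)) := by
  have hX0 : 0 ≤ X := (Finset.sum_nonneg fun _ _ => by positivity).trans hX
  refine (sum_erase_zero_le_of_symm
    (fun v => Finset.sum_nonneg fun d _ => div_nonneg (vectorWeight_nonneg d N v) (by positivity))
    (fun v σ => by simp only [vectorWeight_comp_equiv]) Q).trans ?_
  gcongr
  · calc _ ≤ ∑ i ∈ Finset.Icc 1 Q,
            (N : ℝ) ^ 2 * ∑ d ∈ Finset.Icc 1 D, (Nat.gcd d i : ℝ) / (d * i) :=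
          Finset.sum_le_sum fun i hi => sum_vectorWeight_div_le_of_zero D N
            (Nat.one_le_iff_ne_zero.1 (Finset.mem_Icc.1 hi).1)
      _ ≤ _ := by
          rw [← Finset.mul_sum, Finset.sum_comm]
          gcongr
          exact sum_gcd_div_mul_le_pow_three hDQ hX
  · exact sum_sum_vectorWeight_div_le D N hX0 hτ hX

theorem abs_boxError_le_mul_sum {d Q : ℕ} (hd : Squarefree d) (hQ : d ^ 2 ≤ Q) (k : ℤ) :
    |boxError (Fin 3) d N k| ≤ 8 * (d.divisors.card : ℝ) ^ 4 *
      ∑ v ∈ (Fintype.piFinset fun _ : Fin 3 => Finset.range (Q + 1)).erase 0,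
        vectorWeight d N v / (d : ℝ) ^ 4 := by
  have : NeZero d := ⟨hd.ne_zero⟩
  have hd0 : (0 : ℝ) < (d : ℝ) ^ 4 := pow_pos (by exact_mod_cast Nat.pos_of_ne_zero hd.ne_zero) 4
  have herr := pow_mul_abs_boxError_le (ι := Fin 3) (by simp) hd N k
  have hsum := sum_natAbs_valMinAbs_le (ι := Fin 3) hQ (vectorWeight_nonneg d N)
  rw [Fintype.card_fin] at herr hsum
  rw [← Finset.sum_div, mul_div_assoc', le_div_iff₀ hd0, mul_comm]
  refine herr.trans ((mul_le_mul_of_nonneg_left hsum (by positivity)).trans (le_of_eq ?_))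
  ring

theorem sum_abs_boxError_le (k : ℤ) {X : ℝ} (hX : 1 ≤ X)
    (hτ : ∀ n ≠ 0, n ≤ 3 * (D ^ 2) ^ 2 → (n.divisors.card : ℝ) ≤ X)
    (hX' : ∑ i ∈ Finset.Icc 1 (D ^ 2), (1 : ℝ) / i ≤ X) :
    ∑ d ∈ Finset.Icc 1 D with Squarefree d, |boxError (Fin 3) d N k| ≤
      24 * X ^ 9 * (D ^ 3 + N * D + N ^ 2) := by
  have hDQ : D ≤ D ^ 2 := Nat.le_self_pow two_ne_zero D
  set box := (Fintype.piFinset fun _ : Fin 3 => Finset.range (D ^ 2 + 1)).erase 0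
  have hterm : ∀ d ∈ (Finset.Icc 1 D).filter Squarefree, |boxError (Fin 3) d N k| ≤
      8 * X ^ 4 * ∑ v ∈ box, vectorWeight d N v / (d : ℝ) ^ 4 := fun d hd => by
    obtain ⟨hdD, hsf⟩ := Finset.mem_filter.1 hd
    have hd2 := (Finset.mem_Icc.1 hdD).2
    refine (abs_boxError_le_mul_sum N hsf (Nat.pow_le_pow_left hd2 2) k).trans ?_
    have hτd := hτ d hsf.ne_zero (by nlinarith)
    gcongr
    exact Finset.sum_nonneg fun v _ => div_nonneg (vectorWeight_nonneg d N v) (by positivity)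
  calc _ ≤ ∑ d ∈ Finset.Icc 1 D, 8 * X ^ 4 * ∑ v ∈ box, vectorWeight d N v / (d : ℝ) ^ 4 := by
        refine (Finset.sum_le_sum hterm).trans
          (Finset.sum_le_sum_of_subset_of_nonneg (Finset.filter_subset _ _) fun d _ _ => ?_)
        exact mul_nonneg (by positivity)
          (Finset.sum_nonneg fun v _ => div_nonneg (vectorWeight_nonneg d N v) (by positivity))
    _ = 8 * X ^ 4 * ∑ v ∈ box, ∑ d ∈ Finset.Icc 1 D, vectorWeight d N v / (d : ℝ) ^ 4 := by
        rw [← Finset.mul_sum, Finset.sum_comm]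
    _ ≤ 8 * X ^ 4 * (3 * (N ^ 2 * X ^ 3 + X ^ 3 * (N + D ^ 2 * X) * (D * X))) := by
        gcongr
        exact sum_erase_zero_vectorWeight_div_le D N hDQ hτ hX'
    _ = 24 * (X ^ 7 * N ^ 2 + X ^ 8 * (N * D) + X ^ 9 * D ^ 3) := by ring
    _ ≤ 24 * (X ^ 9 * N ^ 2 + X ^ 9 * (N * D) + X ^ 9 * D ^ 3) := by
        gcongr <;> first | exact hX | norm_num
    _ = _ := by ring

end Ternary

theorem exists_sum_abs_boxError_le {ε : ℝ} (hε : 0 < ε) :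
    ∃ C : ℝ, 0 ≤ C ∧ ∀ (k : ℤ) (D N : ℕ), 1 ≤ D → D ≤ N →
      ∑ d ∈ Finset.Icc 1 D with Squarefree d, |boxError (Fin 3) d N k| ≤
        C * (N : ℝ) ^ ε * (D ^ 3 + N * D + N ^ 2) := by
  set δ := ε / 36 with hδ
  have hδ0 : 0 < δ := by positivity
  obtain ⟨C₁, hC₁, hτ⟩ := exists_card_divisors_le hδ0
  obtain ⟨C₂, hC₂, hharm⟩ := exists_sum_one_div_le hδ0
  refine ⟨24 * (C₁ * C₂ * 3 ^ δ) ^ 9, by positivity, fun k D N hD hDN => ?_⟩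
  have hN1 : (1 : ℝ) ≤ N := by exact_mod_cast hD.trans hDN
  set X := C₁ * C₂ * (3 * (N : ℝ) ^ 4) ^ δ with hX
  have hpow : ∀ n : ℕ, n ≤ 3 * (D ^ 2) ^ 2 → (n : ℝ) ^ δ ≤ (3 * (N : ℝ) ^ 4) ^ δ := fun n hn => by
    refine Real.rpow_le_rpow n.cast_nonneg ?_ hδ0.le
    calc (n : ℝ) ≤ 3 * ((D : ℝ) ^ 2) ^ 2 := by exact_mod_cast hn
      _ ≤ 3 * ((N : ℝ) ^ 2) ^ 2 := by gcongr
      _ = _ := by ring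
  have hX9 : X ^ 9 = (C₁ * C₂ * 3 ^ δ) ^ 9 * (N : ℝ) ^ ε := by
    have hM : (((N : ℝ) ^ 4) ^ δ) ^ 9 = (N : ℝ) ^ ε := by
      rw [← Real.rpow_natCast (N : ℝ) 4, ← Real.rpow_natCast (_ ^ δ) 9,
        ← Real.rpow_mul (by positivity), ← Real.rpow_mul (by positivity), hδ]
      congr 1
      push_cast
      ring
    rw [hX, Real.mul_rpow (by norm_num) (by positivity), ← mul_assoc, mul_pow, hM]
  have hbase : (1 : ℝ) ≤ (3 * (N : ℝ) ^ 4) ^ δ :=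
    Real.one_le_rpow (one_le_mul_of_one_le_of_one_le (by norm_num) (one_le_pow₀ hN1)) hδ0.le
  have key := sum_abs_boxError_le D N k (X := X)
    (one_le_mul_of_one_le_of_one_le (one_le_mul_of_one_le_of_one_le hC₁ hC₂) hbase)
    (fun n hn0 hn => ?_) ?_
  · rwa [hX9, ← mul_assoc] at key
  · refine (hτ n hn0).trans (mul_le_mul ?_ (hpow n hn) (by positivity) (by positivity))
    exact le_mul_of_one_le_right (by positivity) hC₂
  · refine (hharm (D ^ 2) (Nat.one_le_pow _ _ hD)).trans
      (mul_le_mul ?_ (hpow _ (by nlinarith)) (by positivity) (by positivity))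
    exact le_mul_of_one_le_left (by positivity) hC₁

end FrequencySums

section SingularSeries

variable {ι : Type*} [Fintype ι] [DecidableEq ι]

theorem map_mem_quadric {q r : ℕ} [NeZero q] [NeZero r] {k : ℤ} (φ : ZMod q →+* ZMod r)
    {x : ι → ZMod q} (hx : x ∈ quadric ι q k) : φ ∘ x ∈ quadric ι r k := by
  have hφ := congrArg φ (mem_quadric.1 hx)
  rw [map_add, map_intCast, map_zero, RingHom.map_dotProduct] at hφ
  exact mem_quadric.2 hφ

theorem card_quadric_mul {m n : ℕ} [NeZero m] [NeZero n] (h : Nat.Coprime m n) (k : ℤ) :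
    (quadric ι (m * n) k).card = (quadric ι m k).card * (quadric ι n k).card := by
  let e := ZMod.chineseRemainder h
  let φ : ZMod (m * n) →+* ZMod m := (RingHom.fst _ _).comp e.toRingHom
  let ψ : ZMod (m * n) →+* ZMod n := (RingHom.snd _ _).comp e.toRingHom
  have hinj : ∀ a b, φ a = φ b → ψ a = ψ b → a = b := fun a b h₁ h₂ =>
    e.injective (Prod.ext h₁ h₂)
  rw [← Finset.card_product]
  refine Finset.card_bij (fun x _ => (φ ∘ x, ψ ∘ x)) ?_ ?_ ?_
  · exact fun x hx => Finset.mem_product.2 ⟨map_mem_quadric φ hx, map_mem_quadric ψ hx⟩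
  · intro x _ y _ hxy
    obtain ⟨hφ, hψ⟩ := Prod.ext_iff.1 hxy
    exact funext fun i => hinj _ _ (congrFun hφ i) (congrFun hψ i)
  · rintro ⟨a, b⟩ hab
    obtain ⟨ha, hb⟩ := Finset.mem_product.1 hab
    let x : ι → ZMod (m * n) := fun i => e.symm (a i, b i)
    have hφx : φ ∘ x = a := funext fun i => by simp [φ, x]
    have hψx : ψ ∘ x = b := funext fun i => by simp [ψ, x]
    refine ⟨x, mem_quadric.2 (hinj _ _ ?_ ?_), Prod.ext hφx hψx⟩
    · simpa only [map_add, map_intCast, map_zero, RingHom.map_dotProduct, hφx]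
        using mem_quadric.1 ha
    · simpa only [map_add, map_intCast, map_zero, RingHom.map_dotProduct, hψx]
        using mem_quadric.1 hb

theorem sq_mul_card_quadric_sq_le (hι : 2 ≤ Fintype.card ι) {d : ℕ} [NeZero d]
    (hd : Squarefree d) (k : ℤ) :
    (d : ℝ) ^ 2 * (quadric ι (d ^ 2) k).card ≤
      (d.divisors.card : ℝ) ^ (Fintype.card ι + 1) * d ^ (2 * Fintype.card ι) := by
  set n := Fintype.card ι
  have hsum := norm_quadricSum_le (d := d) k (0 : ι → ℤ)
  have hzero : (fun i => (((0 : ι → ℤ) i : ℤ) : ZMod (d ^ 2))) = 0 :=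
    funext fun _ => Int.cast_zero
  rw [hzero, quadricSum_zero, Complex.norm_natCast] at hsum
  have hcrit : ((critSystem d k (0 : ι → ℤ)).card : ℝ) ≤
      (d.divisors.card : ℝ) ^ (n + 1) * d * d ^ (n - 2) := by
    have hgcd : Finset.univ.gcd (fun _ : ι => 0) = 0 := Finset.gcd_eq_zero_iff.2 fun _ _ => rfl
    have hcard := card_critSystem_le hι hd k (0 : ι → ℤ)
    simp only [Pi.zero_apply, Int.natAbs_zero, zero_pow two_ne_zero, Finset.sum_const_zero,
      Nat.gcd_zero_right, hgcd] at hcard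
    exact_mod_cast hcard
  have hpow : (d : ℝ) ^ (n + 1) * (d * d ^ (n - 2)) = d ^ (2 * n) := by
    rw [← pow_succ', ← pow_add]
    congr 1
    omega
  calc _ ≤ _ := hsum
    _ ≤ (d : ℝ) ^ (n + 1) * ((d.divisors.card : ℝ) ^ (n + 1) * d * d ^ (n - 2)) := by gcongr
    _ = (d.divisors.card : ℝ) ^ (n + 1) * (d ^ (n + 1) * (d * d ^ (n - 2))) := by ring
    _ = _ := by rw [hpow]

/-- The `d`-th term of the singular series of the quadric; the series is the expected density of
square-free values of `sumSqAdd k`. -/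
noncomputable def singularTerm (ι : Type*) [Fintype ι] [DecidableEq ι] (k : ℤ) (d : ℕ) : ℝ :=
  ArithmeticFunction.moebius d * boxCount ι (d ^ 2) (d ^ 2) k / (d : ℝ) ^ (2 * Fintype.card ι)

theorem singularTerm_eq_zero_of_not_squarefree (k : ℤ) {d : ℕ} (hd : ¬Squarefree d) :
    singularTerm ι k d = 0 := by
  simp [singularTerm, ArithmeticFunction.moebius_eq_zero_of_not_squarefree hd]

theorem singularTerm_zero (k : ℤ) : singularTerm ι k 0 = 0 :=
  singularTerm_eq_zero_of_not_squarefree k not_squarefree_zero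

theorem singularTerm_one (k : ℤ) : singularTerm ι k 1 = 1 := by
  have hquadric : quadric ι 1 k = Finset.univ :=
    Finset.eq_univ_of_forall fun x => mem_quadric.2 (Subsingleton.elim _ _)
  have hcount : boxCount ι 1 1 k = 1 := by
    rw [← card_quadric_eq_boxCount, hquadric, Finset.card_univ, Fintype.card_unique]
  simp [singularTerm, hcount]

theorem singularTerm_prime (k : ℤ) {p : ℕ} (hp : p.Prime) :
    singularTerm ι k p = -(boxCount ι (p ^ 2) (p ^ 2) k / (p : ℝ) ^ (2 * Fintype.card ι)) := by
  rw [singularTerm, ArithmeticFunction.moebius_apply_prime hp]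
  push_cast
  ring

theorem singularTerm_mul (k : ℤ) {m n : ℕ} (h : Nat.Coprime m n) :
    singularTerm ι k (m * n) = singularTerm ι k m * singularTerm ι k n := by
  rcases eq_or_ne m 0 with rfl | hm
  · rw [zero_mul, singularTerm_zero, zero_mul]
  rcases eq_or_ne n 0 with rfl | hn
  · rw [mul_zero, singularTerm_zero, mul_zero]
  have : NeZero m := ⟨hm⟩
  have : NeZero n := ⟨hn⟩
  simp only [singularTerm, ← card_quadric_eq_boxCount, mul_pow, card_quadric_mul (h.pow 2 2),
    ArithmeticFunction.isMultiplicative_moebius.map_mul_of_coprime h]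
  push_cast
  rw [mul_pow]
  ring

theorem abs_moebius_le_one_real (d : ℕ) : |((ArithmeticFunction.moebius d : ℤ) : ℝ)| ≤ 1 := by
  exact_mod_cast ArithmeticFunction.abs_moebius_le_one

theorem abs_singularTerm_le (hι : 2 ≤ Fintype.card ι) (k : ℤ) (d : ℕ) :
    |singularTerm ι k d| ≤ (d.divisors.card : ℝ) ^ (Fintype.card ι + 1) / (d : ℝ) ^ 2 := by
  by_cases hd : Squarefree d
  · have : NeZero d := ⟨hd.ne_zero⟩
    have hd0 : (0 : ℝ) < d := by exact_mod_cast Nat.pos_of_ne_zero hd.ne_zero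
    rw [singularTerm, abs_div, abs_mul, Nat.abs_cast, abs_of_pos (pow_pos hd0 _),
      div_le_div_iff₀ (pow_pos hd0 _) (pow_pos hd0 2)]
    refine le_trans ?_ (sq_mul_card_quadric_sq_le hι hd k)
    rw [card_quadric_eq_boxCount, mul_comm]
    gcongr
    exact mul_le_of_le_one_left (Nat.cast_nonneg _) (abs_moebius_le_one_real d)
  · rw [singularTerm_eq_zero_of_not_squarefree k hd, abs_zero]
    positivity

theorem exists_abs_singularTerm_le (hι : 2 ≤ Fintype.card ι) {δ : ℝ} (hδ : 0 < δ) :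
    ∃ C : ℝ, 0 ≤ C ∧ ∀ (k : ℤ) (d : ℕ), d ≠ 0 → |singularTerm ι k d| ≤ C * (d : ℝ) ^ (-2 + δ) := by
  set n := Fintype.card ι + 1 with hn
  have hn0 : (n : ℝ) ≠ 0 := by positivity
  obtain ⟨C, hC, hτ⟩ := exists_card_divisors_le (ε := δ / n) (by positivity)
  refine ⟨C ^ n, by positivity, fun k d hd => (abs_singularTerm_le hι k d).trans ?_⟩
  have hd0 : (0 : ℝ) < d := by exact_mod_cast Nat.pos_of_ne_zero hd
  have hpow : (C * (d : ℝ) ^ (δ / n)) ^ n = C ^ n * (d : ℝ) ^ δ := by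
    rw [mul_pow, ← Real.rpow_natCast (_ ^ _) n, ← Real.rpow_mul hd0.le, div_mul_cancel₀ _ hn0]
  rw [div_le_iff₀ (by positivity), mul_assoc, ← Real.rpow_natCast (d : ℝ) 2, ← Real.rpow_add hd0]
  calc (d.divisors.card : ℝ) ^ n ≤ (C * (d : ℝ) ^ (δ / n)) ^ n := by
        gcongr
        exact hτ d hd
    _ = C ^ n * (d : ℝ) ^ (-2 + δ + (2 : ℕ)) := by
        rw [hpow]
        congr 2
        push_cast
        ring

theorem summable_norm_singularTerm (hι : 2 ≤ Fintype.card ι) (k : ℤ) :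
    Summable fun d => ‖singularTerm ι k d‖ := by
  obtain ⟨C, -, hC⟩ := exists_abs_singularTerm_le hι (δ := 1 / 2) (by norm_num)
  have hsum : Summable fun d : ℕ => C * (d : ℝ) ^ (-2 + 1 / 2 : ℝ) :=
    (Real.summable_nat_rpow.2 (by norm_num)).mul_left C
  exact hsum.of_norm_bounded_eventually_nat <|
    (Filter.eventually_ne_atTop 0).mono fun d hd => (norm_norm _).trans_le (hC k d hd)

theorem abs_sum_range_sub_tsum_le {f g : ℕ → ℝ} (hg : Summable g) (hg0 : ∀ d, 0 ≤ g d) {n : ℕ}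
    {K : ℝ} (hK : 0 ≤ K) (hf : ∀ d, n ≤ d → |f d| ≤ K * g d) :
    |∑ d ∈ Finset.range n, f d - ∑' d, f d| ≤ K * ∑' d, g d := by
  have hsumm : Summable f := (hg.mul_left K).of_norm_bounded_eventually_nat <|
    (Filter.eventually_ge_atTop n).mono hf
  have hgn : Summable fun i => g (i + n) := (summable_nat_add_iff n).2 hg
  rw [← hsumm.sum_add_tsum_nat_add n, sub_add_cancel_left, abs_neg]
  calc |∑' i, f (i + n)| ≤ ∑' i, K * g (i + n) :=
        tsum_of_norm_bounded (f := fun i => f (i + n)) (hgn.mul_left K).hasSum fun i =>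
          hf _ (Nat.le_add_left n i)
    _ = K * ∑' i, g (i + n) := tsum_mul_left
    _ ≤ K * ∑' d, g d := by
        refine mul_le_mul_of_nonneg_left ?_ hK
        rw [← hg.sum_add_tsum_nat_add n]
        exact le_add_of_nonneg_left (Finset.sum_nonneg fun d _ => hg0 d)

theorem exists_abs_sum_singularTerm_sub_tsum_le (hι : 2 ≤ Fintype.card ι) {δ : ℝ} (hδ : 0 < δ) :
    ∃ C : ℝ, 0 ≤ C ∧ ∀ (k : ℤ) (D : ℕ), D ≠ 0 →
      |∑ d ∈ Finset.Icc 1 D, singularTerm ι k d - ∑' d, singularTerm ι k d| ≤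
        C * ((D : ℝ) ^ δ / D) := by
  wlog hδ1 : δ ≤ 1 generalizing δ
  · obtain ⟨C, hC0, hC⟩ := this one_pos le_rfl
    refine ⟨C, hC0, fun k D hD => (hC k D hD).trans ?_⟩
    gcongr
    · exact_mod_cast Nat.one_le_iff_ne_zero.2 hD
    · exact (not_le.1 hδ1).le
  obtain ⟨C, hC0, hC⟩ := exists_abs_singularTerm_le hι (half_pos hδ)
  have hg : Summable fun d : ℕ => (d : ℝ) ^ (-1 - δ / 2) :=
    Real.summable_nat_rpow.2 (by linarith)
  refine ⟨C * ∑' d : ℕ, (d : ℝ) ^ (-1 - δ / 2),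
    mul_nonneg hC0 (tsum_nonneg fun d => by positivity), fun k D hD => ?_⟩
  have hD0 : (0 : ℝ) < D := by exact_mod_cast Nat.pos_of_ne_zero hD
  have hrange := sum_range_succ_eq_add_sum_Icc (singularTerm ι k) D
  rw [singularTerm_zero, zero_add] at hrange
  rw [← hrange, mul_right_comm, ← Real.rpow_sub_one hD0.ne']
  refine abs_sum_range_sub_tsum_le hg (fun d => by positivity) (by positivity) fun d hd => ?_
  have hd0 : (0 : ℝ) < d := hD0.trans_le (by exact_mod_cast (Nat.le_succ D).trans hd)
  calc |singularTerm ι k d| ≤ C * (d : ℝ) ^ (-2 + δ / 2) := hC k d (by omega)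
    _ = C * ((d : ℝ) ^ (δ - 1) * (d : ℝ) ^ (-1 - δ / 2)) := by
        rw [← Real.rpow_add hd0]
        ring_nf
    _ ≤ C * ((D : ℝ) ^ (δ - 1) * (d : ℝ) ^ (-1 - δ / 2)) := by
        gcongr C * (?_ * _)
        exact Real.rpow_le_rpow_of_nonpos hD0 (by exact_mod_cast (Nat.le_succ D).trans hd)
          (by linarith)
    _ = _ := by ring

theorem hasProd_one_sub_boxCount_div (hι : 2 ≤ Fintype.card ι) (k : ℤ) :
    HasProd (fun p : Nat.Primes =>
        (1 : ℝ) - boxCount ι ((p : ℕ) ^ 2) ((p : ℕ) ^ 2) k / ((p : ℕ) : ℝ) ^ (2 * Fintype.card ι))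
      (∑' d, singularTerm ι k d) := by
  have hlocal : ∀ p : Nat.Primes, ∑' e, singularTerm ι k ((p : ℕ) ^ e) =
      1 - boxCount ι ((p : ℕ) ^ 2) ((p : ℕ) ^ 2) k / ((p : ℕ) : ℝ) ^ (2 * Fintype.card ι) :=
    fun p => by
      rw [tsum_eq_sum (s := Finset.range 2), Finset.sum_range_succ, Finset.sum_range_one, pow_zero,
        pow_one, singularTerm_one, singularTerm_prime k p.2, ← sub_eq_add_neg]
      intro e he
      rw [Finset.mem_range, not_lt] at he
      refine singularTerm_eq_zero_of_not_squarefree k fun hsf => ?_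
      have := ((Nat.squarefree_pow_iff p.2.ne_one (by omega)).1 hsf).2
      omega
  simpa only [hlocal] using EulerProduct.eulerProduct_hasProd (singularTerm_one (ι := ι) k)
    (singularTerm_mul k) (summable_norm_singularTerm hι k) (singularTerm_zero k)

end SingularSeries

section SquarefreeValues

theorem dvd_of_sq_dvd_sq_mul {a b d : ℕ} (ha : Squarefree a) (h : d ^ 2 ∣ b ^ 2 * a) : d ∣ b := by
  obtain ⟨d', b', hcop, hd, hb⟩ := Nat.exists_coprime d b
  have hgb : Nat.gcd d b ∣ b := Nat.gcd_dvd_right d b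
  generalize Nat.gcd d b = g at hd hb hgb
  rcases Nat.eq_zero_or_pos g with rfl | hg
  · exact zero_dvd_iff.1 hgb ▸ dvd_zero d
  rw [hd, hb, mul_pow, mul_pow, mul_right_comm] at h
  have hdvd : d' ^ 2 ∣ a := (hcop.pow 2 2).dvd_of_dvd_mul_left
    (Nat.dvd_of_mul_dvd_mul_right (pow_pos hg 2) h)
  have hd' : d' = 1 := Nat.isUnit_iff.1 (ha d' (sq d' ▸ hdvd))
  rwa [hd, hd', one_mul]

theorem sum_moebius_filter_sq_dvd {n : ℤ} (hn : n ≠ 0) {Y : ℕ} (hY : n.natAbs ≤ Y)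
    [Decidable (Squarefree n)] :
    ∑ d ∈ Finset.Icc 1 Y with ((d ^ 2 : ℕ) : ℤ) ∣ n, ArithmeticFunction.moebius d =
      if Squarefree n then 1 else 0 := by
  obtain ⟨a, b, hab, ha⟩ := Nat.sq_mul_squarefree n.natAbs
  have hn0 : 0 < n.natAbs := Int.natAbs_pos.2 hn
  have hb : b ≠ 0 := by
    rintro rfl
    exact hn0.ne (by simpa using hab)
  have hset : (Finset.Icc 1 Y).filter (fun d : ℕ => ((d ^ 2 : ℕ) : ℤ) ∣ n) = b.divisors := by
    ext d
    rw [Finset.mem_filter, Finset.mem_Icc, Nat.mem_divisors, Int.natCast_dvd, ← hab]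
    refine ⟨fun h => ⟨dvd_of_sq_dvd_sq_mul ha h.2, hb⟩, fun h => ?_⟩
    have hdn : d ∣ n.natAbs := hab ▸ (h.1.trans (Dvd.intro_left _ (sq b).symm)).mul_right a
    exact ⟨⟨Nat.pos_of_dvd_of_pos hdn hn0, (Nat.le_of_dvd hn0 hdn).trans hY⟩,
      (pow_dvd_pow_of_dvd h.1 2).mul_right a⟩
  have hsf : b = 1 ↔ Squarefree n := by
    rw [← Int.squarefree_natAbs, ← hab]
    refine ⟨?_, fun h => Nat.isUnit_iff.1 (h b ⟨a, by ring⟩)⟩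
    rintro rfl
    simpa using ha
  rw [hset, ← ArithmeticFunction.coe_zeta_mul_apply, ArithmeticFunction.coe_zeta_mul_moebius,
    ArithmeticFunction.one_apply]
  exact if_congr hsf rfl rfl

section General

variable (ι : Type*) [Fintype ι] [DecidableEq ι]

open Classical in
/-- The number of vectors in the box of side `N` at which `sumSqAdd k` is square-free. -/
noncomputable def squarefreeCount (N : ℕ) (k : ℤ) : ℕ :=
  {x ∈ box ι N | Squarefree (sumSqAdd k x)}.card

/-- The number of vectors in the box of side `N` at which `sumSqAdd k` is nonzero and divisible by
`d ^ 2`. -/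
def nonzeroCount (d N : ℕ) (k : ℤ) : ℕ :=
  {x ∈ box ι N | sumSqAdd k x ≠ 0 ∧ ((d ^ 2 : ℕ) : ℤ) ∣ sumSqAdd k x}.card

variable {ι}

theorem natAbs_sumSqAdd_le {N : ℕ} {x : ι → ℕ} (hx : x ∈ box ι N) (k : ℤ) :
    (sumSqAdd k x).natAbs ≤ Fintype.card ι * N ^ 2 + k.natAbs := by
  rw [sumSqAdd_eq_natCast_add]
  refine (Int.natAbs_add_le _ _).trans ?_
  rw [Int.natAbs_natCast]
  gcongr
  refine (Finset.sum_le_card_nsmul _ _ (N ^ 2) fun i _ => ?_).trans_eq (by simp)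
  gcongr
  exact (mem_box.1 hx i).2

theorem card_filter_sumSqAdd_eq_zero_le (N : ℕ) (k : ℤ) :
    {x ∈ box ι N | sumSqAdd k x = 0}.card ≤ k.natAbs ^ Fintype.card ι := by
  have hsub : {x ∈ box ι N | sumSqAdd k x = 0} ⊆ box ι k.natAbs := fun x hx => by
    obtain ⟨hbox, hzero⟩ := Finset.mem_filter.1 hx
    rw [sumSqAdd_eq_natCast_add] at hzero
    have hk : ∑ i, x i ^ 2 = k.natAbs := by omega
    refine mem_box.2 fun i => ⟨(mem_box.1 hbox i).1, ?_⟩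
    rw [← hk]
    exact (Nat.le_self_pow two_ne_zero _).trans
      (Finset.single_le_sum (fun j _ => Nat.zero_le (x j ^ 2)) (Finset.mem_univ i))
  refine (Finset.card_le_card hsub).trans_eq ?_
  simp [box]

theorem boxCount_sq_eq_add (d N : ℕ) (k : ℤ) :
    boxCount ι (d ^ 2) N k =
      nonzeroCount ι d N k + {x ∈ box ι N | sumSqAdd k x = 0}.card := by
  rw [boxCount, nonzeroCount,
    ← Finset.card_filter_add_card_filter_not (fun x => sumSqAdd k x ≠ 0), Finset.filter_filter,
    Finset.filter_filter]
  congr 2 <;> ext x <;> simp +contextual [and_comm]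

theorem squarefreeCount_eq_sum_moebius {N Y : ℕ} {k : ℤ}
    (hY : Fintype.card ι * N ^ 2 + k.natAbs ≤ Y) :
    (squarefreeCount ι N k : ℤ) =
      ∑ d ∈ Finset.Icc 1 Y, ArithmeticFunction.moebius d * (nonzeroCount ι d N k : ℤ) := by
  classical
  have hcount : squarefreeCount ι N k =
      {x ∈ {x ∈ box ι N | sumSqAdd k x ≠ 0} | Squarefree (sumSqAdd k x)}.card := by
    rw [squarefreeCount, Finset.filter_filter]
    congr 1
    ext x
    simp only [Finset.mem_filter]
    exact and_congr_right fun _ => ⟨fun h => ⟨h.ne_zero, h⟩, fun h => h.2⟩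
  calc (squarefreeCount ι N k : ℤ)
      = ∑ x ∈ box ι N with sumSqAdd k x ≠ 0, ∑ d ∈ Finset.Icc 1 Y,
          if ((d ^ 2 : ℕ) : ℤ) ∣ sumSqAdd k x then ArithmeticFunction.moebius d else 0 := by
        rw [hcount, ← Finset.sum_boole]
        refine Finset.sum_congr rfl fun x hx => ?_
        obtain ⟨hbox, hne⟩ := Finset.mem_filter.1 hx
        rw [← sum_moebius_filter_sq_dvd hne ((natAbs_sumSqAdd_le hbox k).trans hY),
          Finset.sum_filter]
    _ = _ := by
        rw [Finset.sum_comm]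
        refine Finset.sum_congr rfl fun d _ => ?_
        rw [← Finset.sum_filter, Finset.filter_filter, Finset.sum_const, nsmul_eq_mul, mul_comm]
        rfl

theorem abs_sum_moebius_mul_le {s : Finset ℕ} {f : ℕ → ℝ} (hf : ∀ d ∈ s, 0 ≤ f d) :
    |∑ d ∈ s, (ArithmeticFunction.moebius d : ℝ) * f d| ≤ ∑ d ∈ s, f d := by
  refine (Finset.abs_sum_le_sum_abs _ _).trans (Finset.sum_le_sum fun d hd => ?_)
  rw [abs_mul, abs_of_nonneg (hf d hd)]
  exact mul_le_of_le_one_left (hf d hd) (abs_moebius_le_one_real d)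

theorem abs_squarefreeCount_sub_sum_le {D N Y : ℕ} {k : ℤ} (hD : D ≤ Y)
    (hY : Fintype.card ι * N ^ 2 + k.natAbs ≤ Y) :
    |(squarefreeCount ι N k : ℝ) -
        ∑ d ∈ Finset.Icc 1 D, (ArithmeticFunction.moebius d : ℝ) * boxCount ι (d ^ 2) N k| ≤
      D * (k.natAbs : ℝ) ^ Fintype.card ι + ∑ d ∈ Finset.Ioc D Y, (nonzeroCount ι d N k : ℝ) := by
  set Z := {x ∈ box ι N | sumSqAdd k x = 0}.card with hZ
  have hZle : (Z : ℝ) ≤ (k.natAbs : ℝ) ^ Fintype.card ι := by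
    exact_mod_cast card_filter_sumSqAdd_eq_zero_le N k
  have hcount : (squarefreeCount ι N k : ℝ) =
      ∑ d ∈ Finset.Icc 1 D, (ArithmeticFunction.moebius d : ℝ) * nonzeroCount ι d N k +
        ∑ d ∈ Finset.Ioc D Y, (ArithmeticFunction.moebius d : ℝ) * nonzeroCount ι d N k := by
    refine Eq.trans ?_ (Finset.sum_Ioc_consecutive _ (Nat.zero_le D) hD).symm
    exact_mod_cast squarefreeCount_eq_sum_moebius hY
  have hsplit : (squarefreeCount ι N k : ℝ) -
      ∑ d ∈ Finset.Icc 1 D, (ArithmeticFunction.moebius d : ℝ) * boxCount ι (d ^ 2) N k =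
      -∑ d ∈ Finset.Icc 1 D, (ArithmeticFunction.moebius d : ℝ) * Z +
        ∑ d ∈ Finset.Ioc D Y, (ArithmeticFunction.moebius d : ℝ) * nonzeroCount ι d N k := by
    simp only [hcount, boxCount_sq_eq_add, Nat.cast_add, mul_add, Finset.sum_add_distrib, ← hZ]
    ring
  rw [hsplit]
  refine (abs_add_le _ _).trans (add_le_add ?_
    (abs_sum_moebius_mul_le fun d _ => Nat.cast_nonneg _))
  rw [abs_neg]
  refine (abs_sum_moebius_mul_le fun d _ => Z.cast_nonneg).trans ?_
  rw [Finset.sum_const, Nat.card_Icc, Nat.add_sub_cancel, nsmul_eq_mul]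
  gcongr

theorem abs_sum_moebius_mul_boxCount_sub_le (D N : ℕ) (k : ℤ) :
    |∑ d ∈ Finset.Icc 1 D, (ArithmeticFunction.moebius d : ℝ) * boxCount ι (d ^ 2) N k -
        (∑ d ∈ Finset.Icc 1 D, singularTerm ι k d) * (N : ℝ) ^ Fintype.card ι| ≤
      ∑ d ∈ Finset.Icc 1 D with Squarefree d, |boxError ι d N k| := by
  rw [Finset.sum_mul, ← Finset.sum_sub_distrib, Finset.sum_filter]
  refine (Finset.abs_sum_le_sum_abs _ _).trans (Finset.sum_le_sum fun d _ => ?_)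
  have herror : (ArithmeticFunction.moebius d : ℝ) * boxCount ι (d ^ 2) N k -
      singularTerm ι k d * (N : ℝ) ^ Fintype.card ι =
        (ArithmeticFunction.moebius d : ℝ) * boxError ι d N k := by
    rw [singularTerm, boxError]
    ring
  rw [herror, abs_mul]
  split_ifs with hsf
  · exact mul_le_of_le_one_left (abs_nonneg _) (abs_moebius_le_one_real d)
  · simp [ArithmeticFunction.moebius_eq_zero_of_not_squarefree hsf]

omit [DecidableEq ι] in
theorem sumSqAdd_pos_of_dvd {q : ℕ} {k : ℤ} {x : ι → ℕ} (hk : k.natAbs < q)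
    (hx : sumSqAdd k x ≠ 0) (hdvd : (q : ℤ) ∣ sumSqAdd k x) : 0 < sumSqAdd k x := by
  by_contra! hneg
  have hle : (q : ℤ) ≤ -sumSqAdd k x :=
    Int.le_of_dvd (by omega) ((dvd_neg).2 hdvd)
  rw [sumSqAdd_eq_natCast_add] at hle
  omega

end General

section Ternary

variable {N T : ℕ} {k : ℤ}

theorem card_filter_sumSqAdd_eq_le (hT : ∀ n ≠ 0, n ≤ 2 * N ^ 2 → n.divisors.card ≤ T) (a : ℕ)
    (m : ℤ) : {x ∈ box (Fin 3) N | x 0 = a ∧ sumSqAdd k x = m}.card ≤ 2 * T ^ 2 := by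
  set s := {x ∈ box (Fin 3) N | x 0 = a ∧ sumSqAdd k x = m}
  rcases s.eq_empty_or_nonempty with hs | ⟨w, hw⟩
  · simp [hs]
  set n := w 1 ^ 2 + w 2 ^ 2
  obtain ⟨hwbox, hw0, hwm⟩ := Finset.mem_filter.1 hw
  have hn0 : n ≠ 0 := by
    have := (mem_box.1 hwbox 1).1
    positivity
  have hnN : n ≤ 2 * N ^ 2 := by
    have h₁ := Nat.pow_le_pow_left (mem_box.1 hwbox 1).2 2
    have h₂ := Nat.pow_le_pow_left (mem_box.1 hwbox 2).2 2
    omega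
  have hinj : Set.InjOn (fun x : Fin 3 → ℕ => (x 1, x 2)) s := fun x hx y hy hxy => by
    obtain ⟨h₁, h₂⟩ := Prod.ext_iff.1 hxy
    have h₀ := (Finset.mem_filter.1 hx).2.1.trans (Finset.mem_filter.1 hy).2.1.symm
    exact funext (Fin.forall_fin_succ.2 ⟨h₀, Fin.forall_fin_two.2 ⟨h₁, h₂⟩⟩)
  rw [← Finset.card_image_of_injOn hinj]
  refine (card_sum_two_squares_le hn0 fun p hp => ?_).trans
    (Nat.mul_le_mul_left 2 (Nat.pow_le_pow_left (hT n hn0 hnN) 2))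
  obtain ⟨x, hx, rfl⟩ := Finset.mem_image.1 hp
  obtain ⟨hbox, hx0, hxm⟩ := Finset.mem_filter.1 hx
  refine ⟨(mem_box.1 hbox 1).1, (mem_box.1 hbox 2).1, ?_⟩
  have hsum := hxm.trans hwm.symm
  rw [sumSqAdd_eq_natCast_add, sumSqAdd_eq_natCast_add, Fin.sum_univ_three, Fin.sum_univ_three,
    hx0, hw0] at hsum
  change x 1 ^ 2 + x 2 ^ 2 = w 1 ^ 2 + w 2 ^ 2
  omega

/- Fix the first coordinate and the quotient of the value by `d ^ 2`; the other two coordinates then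
represent a fixed positive integer as a sum of two squares. -/
theorem nonzeroCount_fin_three_le (hT : ∀ n ≠ 0, n ≤ 2 * N ^ 2 → n.divisors.card ≤ T) {d : ℕ}
    (hd : k.natAbs < d ^ 2) :
    nonzeroCount (Fin 3) d N k ≤ 2 * T ^ 2 * (N * ((3 * N ^ 2 + k.natAbs) / d ^ 2)) := by
  have hd0 : 0 < d ^ 2 := hd.pos
  have hquot : ∀ x : Fin 3 → ℕ, sumSqAdd k x ≠ 0 → ((d ^ 2 : ℕ) : ℤ) ∣ sumSqAdd k x →
      ∃ m : ℕ, 0 < m ∧ sumSqAdd k x = (d ^ 2 * m : ℕ) := fun x hx hdvd => by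
    have hpos := sumSqAdd_pos_of_dvd hd hx hdvd
    lift sumSqAdd k x to ℕ using hpos.le with v
    obtain ⟨m, rfl⟩ := Int.natCast_dvd_natCast.1 hdvd
    exact ⟨m, Nat.pos_of_mul_pos_left (by exact_mod_cast hpos), rfl⟩
  have hmaps : ∀ x ∈ {x ∈ box (Fin 3) N | sumSqAdd k x ≠ 0 ∧ ((d ^ 2 : ℕ) : ℤ) ∣ sumSqAdd k x},
      (x 0, (sumSqAdd k x).natAbs / d ^ 2) ∈
        Finset.Icc 1 N ×ˢ Finset.Icc 1 ((3 * N ^ 2 + k.natAbs) / d ^ 2) := fun x hx => by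
    obtain ⟨hbox, hne, hdvd⟩ := Finset.mem_filter.1 hx
    refine Finset.mem_product.2 ⟨Finset.mem_Icc.2 (mem_box.1 hbox 0), Finset.mem_Icc.2
      ⟨?_, Nat.div_le_div_right (natAbs_sumSqAdd_le hbox k)⟩⟩
    obtain ⟨m, hm, hx⟩ := hquot x hne hdvd
    rwa [hx, Int.natAbs_natCast, Nat.mul_div_cancel_left _ hd0]
  refine (Finset.card_le_mul_card_image_of_maps_to hmaps (2 * T ^ 2) fun am _ => ?_).trans_eq
    (by simp)
  refine (Finset.card_le_card fun x hx => ?_).trans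
    (card_filter_sumSqAdd_eq_le (k := k) hT am.1 (d ^ 2 * am.2 : ℕ))
  obtain ⟨hmem, rfl⟩ := Finset.mem_filter.1 hx
  obtain ⟨hbox, hne, hdvd⟩ := Finset.mem_filter.1 hmem
  obtain ⟨m, -, hm⟩ := hquot x hne hdvd
  refine Finset.mem_filter.2 ⟨hbox, rfl, ?_⟩
  rw [hm, Int.natAbs_natCast, Nat.mul_div_cancel_left _ hd0]

theorem sum_Ioc_natCast_div_sq_le (X Y : ℕ) {D : ℕ} (hD : D ≠ 0) :
    ∑ d ∈ Finset.Ioc D Y, ((X / d ^ 2 : ℕ) : ℝ) ≤ X / D := by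
  calc ∑ d ∈ Finset.Ioc D Y, ((X / d ^ 2 : ℕ) : ℝ)
      ≤ ∑ d ∈ Finset.Ioc D (max D Y), (X : ℝ) * ((d : ℝ) ^ 2)⁻¹ := by
        refine (Finset.sum_le_sum fun d _ => ?_).trans
          (Finset.sum_le_sum_of_subset_of_nonneg
            (Finset.Ioc_subset_Ioc_right (le_max_right D Y)) fun d _ _ => by positivity)
        exact Nat.cast_div_le.trans_eq (by rw [Nat.cast_pow, div_eq_mul_inv])
    _ ≤ X * ((D : ℝ)⁻¹ - ((max D Y : ℕ) : ℝ)⁻¹) := by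
        rw [← Finset.mul_sum]
        gcongr
        exact sum_Ioc_inv_sq_le_sub hD (le_max_left D Y)
    _ ≤ X / D := by
        rw [div_eq_mul_inv]
        gcongr
        exact sub_le_self _ (by positivity)

theorem sum_nonzeroCount_fin_three_le (hT : ∀ n ≠ 0, n ≤ 2 * N ^ 2 → n.divisors.card ≤ T)
    {D : ℕ} (hD : k.natAbs < D) (Y : ℕ) :
    ∑ d ∈ Finset.Ioc D Y, (nonzeroCount (Fin 3) d N k : ℝ) ≤
      2 * (T : ℝ) ^ 2 * (N * ((3 * N ^ 2 + k.natAbs) / D)) := by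
  calc ∑ d ∈ Finset.Ioc D Y, (nonzeroCount (Fin 3) d N k : ℝ)
      ≤ ∑ d ∈ Finset.Ioc D Y,
          2 * (T : ℝ) ^ 2 * (N * (((3 * N ^ 2 + k.natAbs) / d ^ 2 : ℕ) : ℝ)) := by
        refine Finset.sum_le_sum fun d hd => ?_
        have hdk : k.natAbs < d ^ 2 := (hD.trans (Finset.mem_Ioc.1 hd).1).trans_le
          (Nat.le_self_pow two_ne_zero d)
        exact_mod_cast nonzeroCount_fin_three_le hT hdk
    _ ≤ _ := by
        rw [← Finset.mul_sum, ← Finset.mul_sum]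
        gcongr
        exact_mod_cast sum_Ioc_natCast_div_sq_le (3 * N ^ 2 + k.natAbs) Y hD.ne_bot

theorem exists_sum_nonzeroCount_fin_three_le (k : ℤ) {ε : ℝ} (hε : 0 < ε) :
    ∃ C : ℝ, 0 ≤ C ∧ ∀ D N Y : ℕ, k.natAbs < D → N ≠ 0 →
      ∑ d ∈ Finset.Ioc D Y, (nonzeroCount (Fin 3) d N k : ℝ) ≤
        C * (N : ℝ) ^ ε * ((N : ℝ) ^ 3 / D) := by
  set δ := ε / 4 with hδ
  have hδ0 : 0 < δ := by positivity
  obtain ⟨C, hC, hτ⟩ := exists_card_divisors_le hδ0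
  refine ⟨2 * (C * 2 ^ δ) ^ 2 * (3 + k.natAbs), by positivity, fun D N Y hD hN => ?_⟩
  have hN1 : (1 : ℝ) ≤ N := by exact_mod_cast Nat.one_le_iff_ne_zero.2 hN
  set X := C * (2 * (N : ℝ) ^ 2) ^ δ with hX
  have hT : ∀ n ≠ 0, n ≤ 2 * N ^ 2 → n.divisors.card ≤ ⌊X⌋₊ := fun n hn hnN => by
    have hnN' : (n : ℝ) ≤ 2 * (N : ℝ) ^ 2 := by exact_mod_cast hnN
    exact Nat.le_floor ((hτ n hn).trans (by rw [hX]; gcongr))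
  have hX2 : X ^ 2 = (C * 2 ^ δ) ^ 2 * (N : ℝ) ^ ε := by
    have hM : (((N : ℝ) ^ 2) ^ δ) ^ 2 = (N : ℝ) ^ ε := by
      rw [← Real.rpow_natCast (N : ℝ) 2, ← Real.rpow_natCast (_ ^ δ) 2,
        ← Real.rpow_mul (by positivity), ← Real.rpow_mul (by positivity), hδ]
      congr 1
      push_cast
      ring
    rw [hX, Real.mul_rpow (by norm_num) (by positivity), ← mul_assoc, mul_pow, hM]
  calc _ ≤ 2 * (⌊X⌋₊ : ℝ) ^ 2 * (N * ((3 * N ^ 2 + k.natAbs) / D)) :=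
        sum_nonzeroCount_fin_three_le hT hD Y
    _ ≤ 2 * X ^ 2 * (N * ((3 * N ^ 2 + k.natAbs * N ^ 2) / D)) := by
        gcongr
        · exact Nat.floor_le (by positivity)
        · exact le_mul_of_one_le_right (Nat.cast_nonneg _) (one_le_pow₀ hN1)
    _ = _ := by
        rw [hX2]
        ring

end Ternary

end SquarefreeValues

section AsymptoticFormula

theorem exists_abs_sum_singularTerm_mul_pow_sub_le {ι : Type*} [Fintype ι] [DecidableEq ι]
    (hι : 2 ≤ Fintype.card ι) {ε : ℝ} (hε : 0 < ε) :
    ∃ C : ℝ, 0 ≤ C ∧ ∀ (k : ℤ) (D N n : ℕ), D ≠ 0 → D ≤ N →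
      |(∑ d ∈ Finset.Icc 1 D, singularTerm ι k d) * (N : ℝ) ^ n -
          (∑' d, singularTerm ι k d) * (N : ℝ) ^ n| ≤ C * (N : ℝ) ^ ε * ((N : ℝ) ^ n / D) := by
  obtain ⟨C, hC, htail⟩ := exists_abs_sum_singularTerm_sub_tsum_le hι hε
  refine ⟨C, hC, fun k D N n hD hDN => ?_⟩
  rw [← sub_mul, abs_mul, abs_of_nonneg (by positivity : (0 : ℝ) ≤ (N : ℝ) ^ n)]
  calc _ ≤ C * ((D : ℝ) ^ ε / D) * (N : ℝ) ^ n := by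
        gcongr
        exact htail k D hD
    _ ≤ C * ((N : ℝ) ^ ε / D) * (N : ℝ) ^ n := by gcongr
    _ = _ := by ring

theorem exists_abs_squarefreeCount_sub_sum_le (k : ℤ) {ε : ℝ} (hε : 0 < ε) :
    ∃ C : ℝ, 0 ≤ C ∧ ∀ D N : ℕ, k.natAbs < D → D ≤ N →
      |(squarefreeCount (Fin 3) N k : ℝ) -
          ∑ d ∈ Finset.Icc 1 D, (ArithmeticFunction.moebius d : ℝ) * boxCount (Fin 3) (d ^ 2) N k| ≤
        C * (N : ℝ) ^ ε * ((N : ℝ) ^ 2 + (N : ℝ) ^ 3 / D) := by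
  obtain ⟨C, hC, hlarge⟩ := exists_sum_nonzeroCount_fin_three_le k hε
  refine ⟨(k.natAbs : ℝ) ^ 3 + C, by positivity, fun D N hkD hDN => ?_⟩
  have hN : (1 : ℝ) ≤ N := by exact_mod_cast (Nat.one_le_iff_ne_zero.2 hkD.ne_bot).trans hDN
  have hDN' : (D : ℝ) ≤ N := by exact_mod_cast hDN
  have hDY : D ≤ Fintype.card (Fin 3) * N ^ 2 + k.natAbs := by
    rw [Fintype.card_fin]
    have := Nat.le_self_pow two_ne_zero N
    omega
  have hDE : (D : ℝ) ≤ (N : ℝ) ^ ε * (N : ℝ) ^ 2 :=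
    calc (D : ℝ) ≤ (N : ℝ) ^ 2 := hDN'.trans (le_self_pow₀ hN two_ne_zero)
      _ ≤ _ := le_mul_of_one_le_left (by positivity) (Real.one_le_rpow hN hε.le)
  calc _ ≤ _ := abs_squarefreeCount_sub_sum_le hDY le_rfl
    _ ≤ (N : ℝ) ^ ε * (N : ℝ) ^ 2 * (k.natAbs : ℝ) ^ 3 +
          C * (N : ℝ) ^ ε * ((N : ℝ) ^ 3 / D) := by
        rw [Fintype.card_fin]
        gcongr
        exact hlarge D N _ hkD (by rintro rfl; omega)
    _ ≤ _ := by
        rw [← sub_nonneg]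
        ring_nf
        positivity

theorem exists_abs_sum_moebius_mul_boxCount_sub_le {ε : ℝ} (hε : 0 < ε) :
    ∃ C : ℝ, 0 ≤ C ∧ ∀ (k : ℤ) (D N : ℕ), 1 ≤ D → D ≤ N →
      |∑ d ∈ Finset.Icc 1 D, (ArithmeticFunction.moebius d : ℝ) * boxCount (Fin 3) (d ^ 2) N k -
          (∑ d ∈ Finset.Icc 1 D, singularTerm (Fin 3) k d) * (N : ℝ) ^ 3| ≤
        C * (N : ℝ) ^ ε * ((D : ℝ) ^ 3 + (N : ℝ) ^ 2) := by
  obtain ⟨C, hC, herror⟩ := exists_sum_abs_boxError_le hε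
  refine ⟨2 * C, by positivity, fun k D N hD hDN => ?_⟩
  have hbox := abs_sum_moebius_mul_boxCount_sub_le (ι := Fin 3) D N k
  rw [Fintype.card_fin] at hbox
  calc _ ≤ _ := hbox.trans (herror k D N hD hDN)
    _ ≤ C * (N : ℝ) ^ ε * ((D : ℝ) ^ 3 + N * N + (D ^ 3 + (N : ℝ) ^ 2)) := by
        gcongr
        exact le_add_of_nonneg_left (by positivity)
    _ = _ := by ring

theorem exists_abs_squarefreeCount_sub_le (k : ℤ) {ε : ℝ} (hε : 0 < ε) :
    ∃ C : ℝ, 0 ≤ C ∧ ∀ D N : ℕ, k.natAbs < D → D ≤ N →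
      |(squarefreeCount (Fin 3) N k : ℝ) - (∑' d, singularTerm (Fin 3) k d) * (N : ℝ) ^ 3| ≤
        C * (N : ℝ) ^ ε * ((D : ℝ) ^ 3 + (N : ℝ) ^ 2 + (N : ℝ) ^ 3 / D) := by
  obtain ⟨C₁, hC₁, hlarge⟩ := exists_abs_squarefreeCount_sub_sum_le k hε
  obtain ⟨C₂, hC₂, hsmall⟩ := exists_abs_sum_moebius_mul_boxCount_sub_le hε
  obtain ⟨C₃, hC₃, htail⟩ := exists_abs_sum_singularTerm_mul_pow_sub_le (ι := Fin 3) (by simp) hε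
  refine ⟨C₁ + C₂ + C₃, by positivity, fun D N hkD hDN => ?_⟩
  have hD : D ≠ 0 := hkD.ne_bot
  calc _ ≤ _ := (abs_sub_le _ _ _).trans (add_le_add_left (abs_sub_le _ _ _) _)
    _ ≤ C₁ * (N : ℝ) ^ ε * ((N : ℝ) ^ 2 + (N : ℝ) ^ 3 / D) +
          C₂ * (N : ℝ) ^ ε * ((D : ℝ) ^ 3 + (N : ℝ) ^ 2) +
            C₃ * (N : ℝ) ^ ε * ((N : ℝ) ^ 3 / D) :=
        add_le_add (add_le_add (hlarge D N hkD hDN)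
          (hsmall k D N (Nat.one_le_iff_ne_zero.2 hD) hDN)) (htail k D N 3 hD hDN)
    _ ≤ _ := by
        rw [← sub_nonneg]
        ring_nf
        positivity

theorem floor_natCast_rpow_le {N : ℕ} {a : ℝ} (hN : N ≠ 0) (ha : a ≤ 1) : ⌊(N : ℝ) ^ a⌋₊ ≤ N := by
  refine Nat.floor_le_of_le ?_
  simpa only [Real.rpow_one] using Real.rpow_le_rpow_of_exponent_le
    (by exact_mod_cast Nat.one_le_iff_ne_zero.2 hN : (1 : ℝ) ≤ N) ha

theorem cube_add_sq_add_cube_div_le {N D : ℕ} (hN : N ≠ 0) (hD : D = ⌊(N : ℝ) ^ (3 / 4 : ℝ)⌋₊) :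
    (D : ℝ) ^ 3 + (N : ℝ) ^ 2 + (N : ℝ) ^ 3 / D ≤ 4 * (N : ℝ) ^ (9 / 4 : ℝ) := by
  have hN1 : (1 : ℝ) ≤ N := by exact_mod_cast Nat.one_le_iff_ne_zero.2 hN
  set X := (N : ℝ) ^ (3 / 4 : ℝ) with hX
  have hX1 : 1 ≤ X := Real.one_le_rpow hN1 (by norm_num)
  have hDX : (D : ℝ) ≤ X := hD ▸ Nat.floor_le (by positivity)
  have hD1 : (1 : ℝ) ≤ D := by
    rw [hD]
    exact_mod_cast Nat.le_floor (by exact_mod_cast hX1)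
  have hXD : X ≤ 2 * D := by
    have hlt := Nat.lt_floor_add_one X
    rw [← hD] at hlt
    linarith
  have hX3 : (N : ℝ) ^ (9 / 4 : ℝ) = X ^ 3 := by
    rw [hX, ← Real.rpow_mul_natCast (by positivity)]
    norm_num
  have hX4 : (N : ℝ) ^ 3 = X ^ 3 * X := by
    rw [← pow_succ, hX, ← Real.rpow_mul_natCast (by positivity), ← Real.rpow_natCast]
    norm_num
  have hN2 : (N : ℝ) ^ 2 ≤ X ^ 3 := by
    rw [← hX3, ← Real.rpow_natCast]
    exact Real.rpow_le_rpow_of_exponent_le hN1 (by norm_num)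
  have hquot : (N : ℝ) ^ 3 / D ≤ 2 * X ^ 3 := by
    rw [div_le_iff₀ (by positivity), hX4, mul_comm 2, mul_assoc]
    gcongr
  have hcube : (D : ℝ) ^ 3 ≤ X ^ 3 := by gcongr
  linarith

theorem isBigO_squarefreeCount_sub (k : ℤ) {ε : ℝ} (hε : 0 < ε) :
    (fun N : ℕ => (squarefreeCount (Fin 3) N k : ℝ) -
        (∑' d, singularTerm (Fin 3) k d) * (N : ℝ) ^ 3)
      =O[Filter.atTop] fun N : ℕ => (N : ℝ) ^ (9 / 4 + ε) := by
  obtain ⟨C, hC, hbound⟩ := exists_abs_squarefreeCount_sub_le k hε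
  have hlarge : Filter.Tendsto (fun N : ℕ => ⌊(N : ℝ) ^ (3 / 4 : ℝ)⌋₊) Filter.atTop Filter.atTop :=
    tendsto_nat_floor_atTop.comp
      ((tendsto_rpow_atTop (by norm_num)).comp tendsto_natCast_atTop_atTop)
  refine Asymptotics.IsBigO.of_bound (4 * C) ?_
  filter_upwards [hlarge.eventually_gt_atTop k.natAbs, Filter.eventually_ne_atTop 0] with N hkD hN
  rw [Real.norm_eq_abs, Real.norm_of_nonneg (by positivity),
    Real.rpow_add (by exact_mod_cast Nat.pos_of_ne_zero hN)]
  calc _ ≤ _ := hbound _ N hkD (floor_natCast_rpow_le hN (by norm_num))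
    _ ≤ C * (N : ℝ) ^ ε * (4 * (N : ℝ) ^ (9 / 4 : ℝ)) := by
        gcongr
        exact cube_add_sq_add_cube_div_le hN rfl
    _ = _ := by ring

theorem isBigO_floor_rpow {a : ℝ} (ha : 0 ≤ a) :
    (fun H : ℝ => (⌊H⌋₊ : ℝ) ^ a) =O[Filter.atTop] fun H : ℝ => H ^ a := by
  refine Asymptotics.IsBigO.of_bound' ?_
  filter_upwards [Filter.eventually_ge_atTop 0] with H hH
  rw [Real.norm_of_nonneg (by positivity), Real.norm_of_nonneg (by positivity)]
  gcongr
  exact Nat.floor_le hH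

theorem isBigO_floor_pow_succ_sub (n : ℕ) :
    (fun H : ℝ => (⌊H⌋₊ : ℝ) ^ (n + 1) - H ^ (n + 1)) =O[Filter.atTop] fun H : ℝ => H ^ n := by
  refine Asymptotics.IsBigO.of_bound (n + 1) ?_
  filter_upwards [Filter.eventually_ge_atTop 0] with H hH
  have hfloor := Nat.floor_le hH
  have hsub : |(⌊H⌋₊ : ℝ) - H| ≤ 1 :=
    abs_le.2 ⟨by linarith [Nat.lt_floor_add_one H], by linarith⟩
  rw [Real.norm_eq_abs, Real.norm_of_nonneg (by positivity)]
  calc _ ≤ |(⌊H⌋₊ : ℝ) - H| * ((n + 1 : ℕ) : ℝ) * max |(⌊H⌋₊ : ℝ)| |H| ^ n :=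
        abs_pow_sub_pow_le _ _ _
    _ ≤ 1 * ((n + 1 : ℕ) : ℝ) * H ^ n := by
        rw [Nat.abs_cast, abs_of_nonneg hH, max_eq_right hfloor]
        gcongr
    _ = _ := by push_cast; ring

theorem isBigO_pow_rpow {n : ℕ} {a : ℝ} (hna : n ≤ a) :
    (fun H : ℝ => H ^ n) =O[Filter.atTop] fun H : ℝ => H ^ a := by
  refine Asymptotics.IsBigO.of_bound' ?_
  filter_upwards [Filter.eventually_ge_atTop 1] with H hH
  rw [Real.norm_of_nonneg (by positivity), Real.norm_of_nonneg (by positivity),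
    ← Real.rpow_natCast]
  exact Real.rpow_le_rpow_of_exponent_le hH hna

theorem card_filter_product_three (s : Finset ℕ) (p : (Fin 3 → ℕ) → Prop) [DecidablePred p] :
    ((s ×ˢ s ×ˢ s).filter fun t => p ![t.1, t.2.1, t.2.2]).card =
      {x ∈ Fintype.piFinset fun _ : Fin 3 => s | p x}.card := by
  simp only [Finset.card_filter, Finset.sum_product, sum_piFinset_fin_three]

theorem sumSqAdd_fin_three (k : ℤ) (a b c : ℕ) :
    sumSqAdd k ![a, b, c] = (a : ℤ) ^ 2 + (b : ℤ) ^ 2 + (c : ℤ) ^ 2 + k := by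
  simp [sumSqAdd, Fin.sum_univ_three]

theorem lambda_eq_boxCount (q : ℕ) (k : ℤ) : lambda q k = boxCount (Fin 3) q q k := by
  rw [boxCount, box, ← card_filter_product_three]
  simp only [lambda, sumSqAdd_fin_three, Int.modEq_zero_iff_dvd]

theorem S3_eq_squarefreeCount (H : ℝ) (k : ℤ) : S3 H k = squarefreeCount (Fin 3) ⌊H⌋₊ k := by
  rw [squarefreeCount, box, ← card_filter_product_three, S3]
  congr! with t
  exact (sumSqAdd_fin_three k t.1 t.2.1 t.2.2).symm

end AsymptoticFormula

theorem theorem2 (k : ℤ) (ε : ℝ) (hε : 0 < ε) :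
    Multipliable (fun p : Nat.Primes =>
      (1 : ℝ) - (lambda ((p : ℕ) ^ 2) k : ℝ) / ((p : ℕ) : ℝ) ^ 6) ∧
    (fun H : ℝ => (S3 H k : ℝ) -
        (∏' p : Nat.Primes,
          ((1 : ℝ) - (lambda ((p : ℕ) ^ 2) k : ℝ) / ((p : ℕ) : ℝ) ^ 6)) * H ^ 3)
      =O[Filter.atTop] (fun H : ℝ => H ^ ((9 : ℝ) / 4 + ε)) := by
  have hprod : HasProd (fun p : Nat.Primes =>
      (1 : ℝ) - (lambda ((p : ℕ) ^ 2) k : ℝ) / ((p : ℕ) : ℝ) ^ 6)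
      (∑' d, singularTerm (Fin 3) k d) := by
    simpa only [lambda_eq_boxCount, Fintype.card_fin] using
      hasProd_one_sub_boxCount_div (ι := Fin 3) (by simp) k
  refine ⟨hprod.multipliable, ?_⟩
  rw [hprod.tprod_eq]
  have hcount := ((isBigO_squarefreeCount_sub k hε).comp_tendsto
    (tendsto_nat_floor_atTop (α := ℝ))).trans (isBigO_floor_rpow (by positivity))
  have hfloor : (fun H : ℝ => (⌊H⌋₊ : ℝ) ^ 3 - H ^ 3) =O[Filter.atTop]
      fun H => H ^ ((9 : ℝ) / 4 + ε) :=
    (isBigO_floor_pow_succ_sub 2).trans (isBigO_pow_rpow (by push_cast; linarith))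
  refine (hcount.add (hfloor.const_mul_left (∑' d, singularTerm (Fin 3) k d))).congr_left
    fun H => ?_
  rw [S3_eq_squarefreeCount, Function.comp_apply]
  ring
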